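/- All graphs are finite and simple. A tree is \emph{even} if the path between any two distinct leaves (vertices of degree $1$) has an even number of edges; a \emph{spanning even tree} of $G$ is a spanning tree of $G$ that is even. A \emph{block graph} is a graph in which every biconnected component induces a clique. An \emph{admissible coloring} of a tree is a proper $2$-coloring with black and white in which all leaves are black. \textbf{Theorem.} (1) There is a linear-time algorithm that decides whether an input block graph $G$ has a spanning even tree, and that outputs a spanning even tree if one exists. That is: there are a random access machine program and a constant $K$ such that, for every block graph $G$ (connected or not) with $n$ vertices and $m$ edges, given by adjacency lists, the program halts after at most $K(n+m+1)$ steps with the correct answer ``yes'' or ``no'' and, in the case ``yes'', with the $n-1$ edges of a spanning even tree of $G$ as output. (The machine's arithmetic consists of increments and decrements by one and comparisons, with indirect access to memory, each at unit cost.) (2) Let $G$ be a connected block graph with at least three vertices, and let $\mathcal T$ be its block-cut tree, whose nodes are the maximal cliques and the cut vertices of $G$, a clique $B$ and a cut vertex $c$ being adjacent if and only if $c\in B$. Root $\mathcal T$ at an arbitrary node, and consider the following procedure. \begin{enumerate} \item Color all vertices of degree $1$ black; the others are uncolored. \item As long as there is a maximal clique $B$ with exactly one uncolored vertex $v$ whose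 other vertices all have the same color, choose such a $B$ and give $v$ the opposite color. Call the resulting partial coloring $c'$. \item Let $G'$ be obtained from $G$ by deleting all edges whose two ends have the same color under $c'$. If $G'$ is disconnected, answer ``no''. \item Otherwise, as long as possible, choose a maximal clique $B$ that has an uncolored vertex $v$ and all of whose proper ancestor cliques in $\mathcal T$ have no uncolored vertex. If $B$ has no white vertex, color $v$ white and all other uncolored vertices of $B$ black; otherwise color all uncolored vertices of $B$ black. Call the resulting coloring $c''$. \item Let $G''$ be obtained from $G'$ by deleting all edges whose two ends have the same color under $c''$. Output any spanning tree of $G''$. \end{enumerate} Then, whatever choices are made: Steps 2 and 4 terminate; for every spanning even tree $T$ of $G$ and every admissible coloring $c$ of $T$, $c(v)=c'(v)$ for every vertex $v$ colored by $c'$; if $G'$ is disconnected, then $G$ has no spanning even tree; and if $G'$ is connected, then $G''$ is connected and every spanning tree of $G''$ is a spanning even tree of $G$. -/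

import Mathlib

namespace EvenTree

section Graphs

variable {V : Type*}

/-- A leaf of a graph is a vertex of degree one. -/
def IsLeaf (G : SimpleGraph V) (v : V) : Prop := (G.neighborSet v).ncard = 1

/-- An even tree: a tree in which the path between any two distinct leaves has an even number
of edges. -/
def IsEvenTree (T : SimpleGraph V) : Prop :=
  T.IsTree ∧ ∀ u v : V, IsLeaf T u → IsLeaf T v → u ≠ v →
    ∀ p : T.Walk u v, p.IsPath → Even p.length

/-- A spanning even tree of `G`: an even tree on all the vertices, with edges from `G`. -/
def IsSpanningEvenTree (G T : SimpleGraph V) : Prop := T ≤ G ∧ IsEvenTree T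

/-- A nonempty vertex set that induces a connected graph without a cut vertex. -/
def IsNonseparable (G : SimpleGraph V) (B : Set V) : Prop :=
  (G.induce B).Connected ∧ ∀ x ∈ B, (G.induce (B \ {x})).Preconnected

/-- The vertex set of a biconnected component (block); a bridge and an isolated vertex count
as blocks. -/
def IsBlock (G : SimpleGraph V) (B : Set V) : Prop := Maximal (IsNonseparable G) B

/-- A block graph: every biconnected component induces a clique. Connectedness is not required. -/
def IsBlockGraph (G : SimpleGraph V) : Prop := ∀ B : Set V, IsBlock G B → G.IsClique B

def IsMaximalClique (G : SimpleGraph V) (B : Set V) : Prop := Maximal G.IsClique B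

/-- A cut vertex: its deletion separates two other vertices that are joined in `G`. -/
def IsCutVertex (G : SimpleGraph V) (c : V) : Prop :=
  ∃ u w : V, u ≠ c ∧ w ≠ c ∧ G.Reachable u w ∧ ¬ (G.deleteIncidenceSet c).Reachable u w

/-- The nodes of the block-cut tree of a block graph: maximal cliques and cut vertices. -/
abbrev BlockCutNode (G : SimpleGraph V) : Type _ :=
  {B : Set V // IsMaximalClique G B} ⊕ {c : V // IsCutVertex G c}

/-- The block-cut tree: a clique `B` and a cut vertex `c` are adjacent when `c ∈ B`. -/
def blockCutTree (G : SimpleGraph V) : SimpleGraph (BlockCutNode G) where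
  Adj
    | .inl B, .inr c => c.1 ∈ B.1
    | .inr c, .inl B => c.1 ∈ B.1
    | _, _ => False
  symm := ⟨by rintro (B | c) (B' | c') h <;> exact h⟩
  loopless := ⟨by rintro (B | c) h <;> exact h⟩

/-- In a tree rooted at `r`: `x` lies on the path from `r` to `y` (so `y` is its own ancestor). -/
def IsAncestor {N : Type*} (T : SimpleGraph N) (r x y : N) : Prop :=
  ∀ p : T.Walk r y, p.IsPath → x ∈ p.support

/-! Colorings: `true` is black and `false` is white; in a partial coloring `none` is uncolored. -/

/-- An admissible coloring of a tree: a proper 2-coloring with all leaves black. -/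
def IsAdmissible (T : SimpleGraph V) (c : V → Bool) : Prop :=
  (∀ u v : V, T.Adj u v → c u ≠ c v) ∧ ∀ v : V, IsLeaf T v → c v = true

/-- `t` results from `s` by repeating the step `R` until no further step is possible. -/
def Exhaust {S : Type*} (R : S → S → Prop) (s t : S) : Prop :=
  Relation.ReflTransGen R s t ∧ ∀ t', ¬ R t t'

open Classical in
/-- The degree-one vertices are black, all others are uncolored. -/
noncomputable def initialColoring (G : SimpleGraph V) : V → Option Bool :=
  fun v => if IsLeaf G v then some true else none

open Classical in
/-- One forced coloring: the last uncolored vertex `v` of a maximal clique whose other vertices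
all have the color `b` gets the opposite color. -/
def ForceStep (G : SimpleGraph V) (c c' : V → Option Bool) : Prop :=
  ∃ B : Set V, IsMaximalClique G B ∧ ∃ v ∈ B, c v = none ∧
    ∃ b : Bool, (∀ u ∈ B, u ≠ v → c u = some b) ∧ c' = Function.update c v (some (!b))

/-- A result of the forced coloring propagation. -/
def IsForcedColoring (G : SimpleGraph V) (c : V → Option Bool) : Prop :=
  Exhaust (ForceStep G) (initialColoring G) c

/-- Delete all edges whose two ends have the same color. -/
def bichromatic (G : SimpleGraph V) (c : V → Option Bool) : SimpleGraph V where
  Adj u v := G.Adj u v ∧ ¬ ∃ b : Bool, c u = some b ∧ c v = some b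
  symm := ⟨fun _ _ h => ⟨h.1.symm, fun ⟨b, h1, h2⟩ => h.2 ⟨b, h2, h1⟩⟩⟩
  loopless := ⟨fun v h => G.loopless.irrefl v h.1⟩

open Classical in
/-- Color all uncolored vertices of `B` black, except that `v` becomes white if `B` has no
white vertex so far. -/
noncomputable def fillClique (c : V → Option Bool) (B : Set V) (v : V) : V → Option Bool :=
  fun w => if w ∈ B ∧ c w = none then
      (if w = v ∧ ∀ u ∈ B, c u ≠ some false then some false else some true)
    else c w

/-- One step of the top-down coloring along the block-cut tree rooted at `r`: choose a maximal
clique `B` with an uncolored vertex `v`, all of whose proper ancestor cliques are fully colored,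
and color it. -/
def TopDownStep (G : SimpleGraph V) (r : BlockCutNode G) (c c' : V → Option Bool) : Prop :=
  ∃ B : {B : Set V // IsMaximalClique G B},
    (∀ B' : {B : Set V // IsMaximalClique G B},
      IsAncestor (blockCutTree G) r (.inl B') (.inl B) → B' ≠ B → ∀ u ∈ B'.1, c u ≠ none) ∧
    ∃ v ∈ B.1, c v = none ∧ c' = fillClique c B.1 v

end Graphs

section Machine

/-! A random access machine with structured control flow. Its memory consists of registers and
of arrays of natural numbers (a program mentions finitely many of each), with indirect access to
array entries. The only arithmetic is adding and subtracting one, so that in `t` steps no value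
exceeds the largest value of input and program by more than `t`: unit cost is realistic. -/

structure RAMState where
  reg : ℕ → ℕ
  arr : ℕ → ℕ → ℕ

inductive Cond where
  /-- register `x` equals register `y` -/
  | eq (x y : ℕ)
  /-- register `x` is less than register `y` -/
  | lt (x y : ℕ)

def Cond.Holds (s : RAMState) : Cond → Prop
  | .eq x y => s.reg x = s.reg y
  | .lt x y => s.reg x < s.reg y

inductive Program where
  | skip
  /-- `reg x := k` -/
  | const (x k : ℕ)
  /-- `reg x := reg y` -/
  | copy (x y : ℕ)
  /-- `reg x := reg x + 1` -/
  | inc (x : ℕ)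
  /-- `reg x := reg x - 1`, truncated at zero -/
  | dec (x : ℕ)
  /-- `reg x := arr a (reg i)` -/
  | load (x a i : ℕ)
  /-- `arr a (reg i) := reg x` -/
  | store (a i x : ℕ)
  | seq (P Q : Program)
  | ite (b : Cond) (P Q : Program)
  /-- as long as `b` holds, run `P` -/
  | loop (b : Cond) (P : Program)

def RAMState.setReg (s : RAMState) (x k : ℕ) : RAMState :=
  ⟨Function.update s.reg x k, s.arr⟩

def RAMState.setArr (s : RAMState) (a i k : ℕ) : RAMState :=
  ⟨s.reg, Function.update s.arr a (Function.update (s.arr a) i k)⟩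

/-- `Exec P s t s'`: the program `P`, started in state `s`, halts after exactly `t` steps in
state `s'`. Every elementary instruction and every evaluation of a condition is one step. -/
inductive Exec : Program → RAMState → ℕ → RAMState → Prop where
  | skip (s : RAMState) : Exec .skip s 1 s
  | const (s : RAMState) (x k : ℕ) : Exec (.const x k) s 1 (s.setReg x k)
  | copy (s : RAMState) (x y : ℕ) : Exec (.copy x y) s 1 (s.setReg x (s.reg y))
  | inc (s : RAMState) (x : ℕ) : Exec (.inc x) s 1 (s.setReg x (s.reg x + 1))
  | dec (s : RAMState) (x : ℕ) : Exec (.dec x) s 1 (s.setReg x (s.reg x - 1))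
  | load (s : RAMState) (x a i : ℕ) :
      Exec (.load x a i) s 1 (s.setReg x (s.arr a (s.reg i)))
  | store (s : RAMState) (a i x : ℕ) :
      Exec (.store a i x) s 1 (s.setArr a (s.reg i) (s.reg x))
  | seq {P Q : Program} {s₁ s₂ s₃ : RAMState} {t u : ℕ} :
      Exec P s₁ t s₂ → Exec Q s₂ u s₃ → Exec (.seq P Q) s₁ (t + u) s₃
  | iteTrue {b : Cond} {P Q : Program} {s s' : RAMState} {t : ℕ} :
      b.Holds s → Exec P s t s' → Exec (.ite b P Q) s (1 + t) s'
  | iteFalse {b : Cond} {P Q : Program} {s s' : RAMState} {t : ℕ} :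
      ¬ b.Holds s → Exec Q s t s' → Exec (.ite b P Q) s (1 + t) s'
  | loopDone {b : Cond} {P : Program} {s : RAMState} :
      ¬ b.Holds s → Exec (.loop b P) s 1 s
  | loopStep {b : Cond} {P : Program} {s₁ s₂ s₃ : RAMState} {t u : ℕ} :
      b.Holds s₁ → Exec P s₁ t s₂ → Exec (.loop b P) s₂ u s₃ →
      Exec (.loop b P) s₁ (1 + t + u) s₃

/-- `adj v` lists the neighbors of `v` in `G`, each once and in any order. -/
def IsAdjacencyList {n : ℕ} (G : SimpleGraph (Fin n)) (adj : Fin n → List (Fin n)) : Prop :=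
  ∀ v : Fin n, (adj v).Nodup ∧ ∀ u : Fin n, u ∈ adj v ↔ G.Adj v u

/-- The initial state for a graph on `0, …, n - 1` given by adjacency lists: register 0 holds
`n`, array 1 holds the concatenation of the lists of `0, …, n - 1`, and entry `v ≤ n` of array 0
is the position in array 1 at which the list of `v` begins (and that of `v - 1` ends). Everything
else is zero. -/
def inputState {n : ℕ} (adj : Fin n → List (Fin n)) : RAMState where
  reg := fun r => if r = 0 then n else 0
  arr := fun a i =>
    if a = 0 then (if i ≤ n then ((List.ofFn adj).take i).flatten.length else 0)
    else if a = 1 then ((List.ofFn adj).flatten.map Fin.val).getD i 0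
    else 0

/-- The edges of `T` are the pairs `{arr 2 i, arr 3 i}` with `i < n - 1`. -/
def OutputsEdges {n : ℕ} (s : RAMState) (T : SimpleGraph (Fin n)) : Prop :=
  ∀ u v : Fin n, T.Adj u v ↔ ∃ i < n - 1,
    (s.arr 2 i = u ∧ s.arr 3 i = v) ∨ (s.arr 2 i = v ∧ s.arr 3 i = u)

/-- In the final state `s`, register 1 holds the answer `1` ("yes") or `0` ("no") to whether `G`
has a spanning even tree, and with the answer `1` a spanning even tree has been output. -/
def IsCorrectOutput {n : ℕ} (G : SimpleGraph (Fin n)) (s : RAMState) : Prop :=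
  (s.reg 1 = 1 ∧ ∃ T : SimpleGraph (Fin n), IsSpanningEvenTree G T ∧ OutputsEdges s T) ∨
  (s.reg 1 = 0 ∧ ¬ ∃ T : SimpleGraph (Fin n), IsSpanningEvenTree G T)

end Machine

end EvenTree

open EvenTree

/-!
Everything about block graphs rests on one fact, `IsMaximalClique.mem_of_mem_support`: a path
between two vertices of a maximal clique stays in the clique. Hence distinct maximal cliques share
at most one vertex, and a connected spanning subgraph has, at each vertex of a maximal clique with
at least two vertices, an edge inside that clique.

The link between colorings and even trees is the notion of a good coloring, `IsGoodColoring`: leaves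
are black, no maximal clique with two vertices is monochromatic, and each white vertex is the only
white vertex of some maximal clique. In a connected block graph, the bichromatic edges of a good
coloring form a connected graph, and in each spanning tree of that graph all leaves are black, so
that the tree is even (`IsGoodColoring.isSpanningEvenTree`). Conversely, an admissible coloring of a
spanning even tree is not constant on a maximal clique with two vertices, so the color propagation
only assigns colors that every admissible coloring has (`IsForcedInvariant`).

For the coloring procedure it remains to see that the top-down coloring ends with a good coloring.
The danger is a clique that is completed by the coloring of other cliques and becomes
monochromatic. But if a clique `B` still has an uncolored vertex, a vertex of `B` can have been
colored during the top-down phase only through a clique that is not below `B`, and all these meet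
`B` in one vertex (`eq_of_not_isAncestor`). So the other vertices of `B` have their colors from the
propagation, which has stopped; hence both colors occur among them (`IsTopDownInvariant`).

The algorithm does without the block-cut tree. In a breadth-first search tree of a block graph, each
edge joins a child to its parent or two children of the same parent, and the maximal cliques are the
sets that consist of a vertex, its parent, and its adjacent siblings
(`IsSearchTree.isMaximalClique_upClique`, `IsSearchTree.exists_eq_upClique`). A pass through the
vertices in reverse order of discovery performs all propagations from siblings to their common
parent; if such a clique is found monochromatic, there is no spanning even tree. A second pass, in
the order of discovery, colors an uncolored vertex white unless its parent or a sibling is white.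
The result is a good coloring (`IsSearchTree.isGoodColoring`), even though forced colors are not
propagated from a parent to its children: for the last uncolored vertex of a clique whose other
vertices have the same color, the rule of the second pass chooses the opposite color anyway. Finally
each vertex but the root is linked to its parent or, if that has the same color, to a sibling of the
other color; these links are a spanning tree with bichromatic edges (`IsLink.isTree`).

Programs are verified with weakest preconditions that include the clock (`Runs`). Each pass inspects
the adjacency list of each vertex a bounded number of times, so its cost is charged to the vertices,
and the degrees add up to `2 * m`.
-/

namespace EvenTree

open SimpleGraph

section BlockGraphs

variable {V : Type*} {G H T : SimpleGraph V} {B B' : Set V}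

/-! ### Maximal cliques of block graphs -/

/-- A vertex set is preconnected if each of its vertices can be joined, inside the set, to a
vertex of a clique `B`. -/
lemma induce_preconnected_of_clique {R : Set V} (hB : G.IsClique B)
    (h : ∀ w ∈ R, ∃ b ∈ B, ∃ p : G.Walk w b, ∀ x ∈ p.support, x ∈ R) :
    (G.induce R).Preconnected := by
  rintro ⟨w, hw⟩ ⟨w', hw'⟩
  obtain ⟨b, hb, p, hp⟩ := h w hw
  obtain ⟨b', hb', p', hp'⟩ := h w' hw'
  have hbb : (G.induce R).Reachable ⟨b, hp b p.end_mem_support⟩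
      ⟨b', hp' b' p'.end_mem_support⟩ := by
    by_cases e : b = b'
    · subst e; exact Reachable.refl _
    · exact Adj.reachable (induce_adj.2 (hB hb hb' e))
  exact ((p.induce R hp).reachable.trans hbb).trans (p'.induce R hp').reachable.symm

/-- A clique together with a path between two of its vertices has no cut vertex: after the
deletion of `x`, each remaining vertex of the path still reaches one of the two ends. -/
lemma isNonseparable_union_path (hB : G.IsClique B) {u v : V} (hu : u ∈ B) (hv : v ∈ B)
    {p : G.Walk u v} (hp : p.IsPath) : IsNonseparable G (B ∪ {x | x ∈ p.support}) := by
  classical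
  refine ⟨(connected_iff _).2 ⟨induce_preconnected_of_clique hB ?_, ⟨u, .inl hu⟩⟩, fun x _ =>
    induce_preconnected_of_clique hB ?_⟩
  · rintro w (hw | hw)
    · exact ⟨w, hw, .nil, by simp [hw]⟩
    · refine ⟨u, hu, (p.takeUntil w hw).reverse, fun y hy => .inr ?_⟩
      exact p.support_takeUntil_subset_support hw (by simpa using hy)
  · rintro w ⟨hw | hw, hwx⟩
    · exact ⟨w, hw, .nil, by simpa using ⟨.inl hw, hwx⟩⟩
    · obtain ⟨q, r, -, -, rfl⟩ := hp.mem_support_iff_exists_append.1 hw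
      by_cases hxq : x ∈ q.support
      · refine ⟨v, hv, r, fun y hy => ⟨.inr ?_, fun hyx => ?_⟩⟩
        · simp [Walk.mem_support_append_iff, hy]
        · rw [Set.mem_singleton_iff] at hyx
          subst hyx
          exact hp.ne_of_mem_support_of_append (fun h => hwx h.symm) hxq hy rfl
      · refine ⟨u, hu, q.reverse, fun y hy => ⟨.inr ?_, fun hyx => hxq ?_⟩⟩
        · simp only [Walk.support_reverse, List.mem_reverse] at hy
          simp [Walk.mem_support_append_iff, hy]
        · rw [Set.mem_singleton_iff] at hyx
          subst hyx
          simpa using hy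

lemma exists_isMaximalClique [Finite V] {C : Set V} (hC : G.IsClique C) :
    ∃ B, IsMaximalClique G B ∧ C ⊆ B := by
  obtain ⟨B, hCB, hB⟩ := Finite.exists_le_maximal (p := G.IsClique) hC
  exact ⟨B, hB, hCB⟩

lemma exists_isMaximalClique_of_adj [Finite V] {u v : V} (h : G.Adj u v) :
    ∃ B, IsMaximalClique G B ∧ u ∈ B ∧ v ∈ B := by
  obtain ⟨B, hB, hs⟩ := exists_isMaximalClique (G := G) (C := {u, v})
    (by rw [isClique_pair]; exact fun _ => h)
  exact ⟨B, hB, hs (by simp), hs (by simp)⟩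

/-- The convexity of the maximal cliques of a block graph, from which everything else about block
graphs is derived: a path between two vertices of a maximal clique stays in that clique. -/
lemma IsMaximalClique.mem_of_mem_support [Finite V] (hG : IsBlockGraph G)
    (hB : IsMaximalClique G B) {u v : V} (hu : u ∈ B) (hv : v ∈ B)
    {p : G.Walk u v} (hp : p.IsPath) {x : V} (hx : x ∈ p.support) : x ∈ B := by
  obtain ⟨C, hSC, hC⟩ := Finite.exists_le_maximal (isNonseparable_union_path hB.1 hu hv hp)
  exact hB.2 (hG C hC) (fun y hy => hSC (.inl hy)) (hSC (.inr hx))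

lemma IsMaximalClique.mem_of_adj_adj [Finite V] (hG : IsBlockGraph G)
    (hB : IsMaximalClique G B) {u v w : V} (hu : u ∈ B) (hv : v ∈ B) (huv : u ≠ v)
    (huw : G.Adj u w) (hwv : G.Adj w v) : w ∈ B := by
  have hp : (Walk.cons huw (.cons hwv .nil)).IsPath := by
    simp [huw.ne, hwv.ne, huv]
  exact hB.mem_of_mem_support hG hu hv hp (by simp)

/-- Distinct maximal cliques of a block graph share at most one vertex. -/
lemma IsMaximalClique.eq_of_mem_of_mem [Finite V] (hG : IsBlockGraph G)
    (hB : IsMaximalClique G B) (hB' : IsMaximalClique G B') {u v : V} (huv : u ≠ v)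
    (hu : u ∈ B) (hv : v ∈ B) (hu' : u ∈ B') (hv' : v ∈ B') : B = B' := by
  have key : B' ⊆ B := fun w hw => by
    by_cases hwu : w = u
    · exact hwu ▸ hu
    by_cases hwv : w = v
    · exact hwv ▸ hv
    exact hB.mem_of_adj_adj hG hu hv huv (hB'.1 hu' hw (Ne.symm hwu)) (hB'.1 hw hv' hwv)
  exact Set.Subset.antisymm (hB'.2 hB.1 key) key

/-- A connected spanning subgraph of a block graph has an edge at `u` inside each maximal clique
that contains `u` and another vertex. -/
lemma IsMaximalClique.exists_adj_of_connected [Finite V] (hG : IsBlockGraph G)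
    (hB : IsMaximalClique G B) (hHG : H ≤ G) (hH : H.Connected) {u v : V} (hu : u ∈ B)
    (hv : v ∈ B) (huv : u ≠ v) : ∃ w ∈ B, H.Adj u w := by
  obtain ⟨p, hp⟩ := hH.exists_isPath u v
  have hs : ∀ x ∈ p.support, x ∈ B := fun x hx =>
    hB.mem_of_mem_support hG hu hv (hp.mapLe hHG) (by simpa using hx)
  cases p with
  | nil => exact absurd rfl huv
  | cons h q => exact ⟨_, hs _ (by simp), h⟩

lemma IsMaximalClique.exists_ne [Finite V] [Nontrivial V] (hc : G.Connected)
    (hB : IsMaximalClique G B) (v : V) : ∃ u ∈ B, u ≠ v := by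
  by_contra! h
  obtain ⟨a, ha⟩ := hc.preconnected.exists_adj_of_nontrivial v
  obtain ⟨C, hC, hv, ha'⟩ := exists_isMaximalClique_of_adj ha
  have : C ⊆ B := hB.2 hC.1 fun u hu => h u hu ▸ hv
  exact ha.ne' (h a (this ha'))

/-! ### Good colorings and even trees -/

lemma IsLeaf.eq_of_adj {v a b : V} (h : IsLeaf G v) (ha : G.Adj v a) (hb : G.Adj v b) : a = b := by
  obtain ⟨x, hx⟩ := Set.ncard_eq_one.1 h
  have h1 : a ∈ G.neighborSet v := ha
  have h2 : b ∈ G.neighborSet v := hb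
  rw [hx] at h1 h2
  exact h1.trans h2.symm

lemma IsLeaf.exists_adj {v : V} (h : IsLeaf G v) : ∃ a, G.Adj v a := by
  obtain ⟨x, hx⟩ := Set.ncard_eq_one.1 h
  exact ⟨x, show x ∈ G.neighborSet v by simp [hx]⟩

lemma isLeaf_of_unique_adj {v a : V} (ha : G.Adj v a) (h : ∀ b, G.Adj v b → b = a) :
    IsLeaf G v :=
  Set.ncard_eq_one.2 ⟨a, Set.ext fun b => ⟨fun hb => h b hb, fun hb => by
    rw [Set.mem_singleton_iff.1 hb]; exact ha⟩⟩

/-- The colorings for which every spanning tree with bichromatic edges is even: leaves are black,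
no maximal clique with at least two vertices is monochromatic, and each white vertex is the only
white vertex of one of its maximal cliques. -/
structure IsGoodColoring (G : SimpleGraph V) (c : V → Bool) : Prop where
  leaf : ∀ v, IsLeaf G v → c v = true
  bichromatic : ∀ B, IsMaximalClique G B → ∀ u ∈ B, ∀ v ∈ B, u ≠ v → ∃ w ∈ B, c w ≠ c u
  white : ∀ v, c v = false → ∃ B, IsMaximalClique G B ∧ v ∈ B ∧ ∀ u ∈ B, u ≠ v → c u = true

/-- The bichromatic edges of a good coloring form a connected graph. -/
lemma IsGoodColoring.connected [Finite V] {c : V → Bool} (h : IsGoodColoring G c)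
    (hc : G.Connected) (hH : ∀ u v, G.Adj u v → c u ≠ c v → H.Adj u v) : H.Connected := by
  refine (connected_iff _).2 ⟨fun u v => ?_, hc.nonempty⟩
  obtain ⟨p⟩ := hc.preconnected u v
  induction p with
  | nil => exact Reachable.refl _
  | @cons u v w huv q ih =>
    refine Reachable.trans ?_ ih
    by_cases e : c u = c v
    · obtain ⟨B, hB, hu, hv⟩ := exists_isMaximalClique_of_adj huv
      obtain ⟨w, hw, hwu⟩ := h.bichromatic B hB u hu v hv huv.ne
      have h1 : u ≠ w := fun e => hwu (e ▸ rfl)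
      have h2 : w ≠ v := fun e' => hwu (by rw [e, e'])
      exact (hH _ _ (hB.1 hu hw h1) hwu.symm).reachable.trans
        (hH _ _ (hB.1 hw hv h2) (e ▸ hwu)).reachable
    · exact (hH _ _ huv e).reachable

/-- In a spanning tree with bichromatic edges for a good coloring no leaf is white, since a white
vertex `v` has two tree neighbors: either in the clique in which it is the only white vertex, or,
if that clique is an edge, in two cliques that contain it. -/
lemma IsGoodColoring.leaf_of_connected [Finite V] (hG : IsBlockGraph G) {c : V → Bool}
    (h : IsGoodColoring G c) (hTG : T ≤ G) (hT : T.Connected)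
    (hTc : ∀ u v, T.Adj u v → c u ≠ c v) {v : V} (hv : IsLeaf T v) : c v = true := by
  by_contra hcv
  obtain ⟨a, ha⟩ := hv.exists_adj
  obtain ⟨B, hB, hvB, hblack⟩ := h.white v (by simpa using hcv)
  have hstar : ∀ u ∈ B, u ≠ v → T.Adj v u := by
    intro u hu huv
    obtain ⟨w, hw, huw⟩ := hB.exists_adj_of_connected hG hTG hT hu hvB huv
    have : w = v := by
      by_contra hwv
      exact hTc _ _ huw (by rw [hblack u hu huv, hblack w hw hwv])
    exact this ▸ huw.symm
  have hall : ∀ u ∈ B, u ≠ v → u = a := fun u hu huv => hv.eq_of_adj (hstar u hu huv) ha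
  have haB : a ∈ B := by
    have hcl : G.IsClique {v, a} := by rw [isClique_pair]; exact fun _ => hTG ha
    by_contra haB
    refine haB (hB.2 hcl (fun u hu => ?_) (by simp))
    by_cases huv : u = v
    · simp [huv]
    · simp [hall u hu huv]
  refine hcv (h.leaf v (isLeaf_of_unique_adj (hTG ha) fun x hx => ?_))
  obtain ⟨B', hB', hvB', hxB'⟩ := exists_isMaximalClique_of_adj hx
  obtain ⟨w, hw, hvw⟩ := hB'.exists_adj_of_connected hG hTG hT hvB' hxB' hx.ne
  obtain rfl := hv.eq_of_adj ha hvw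
  have := hB.eq_of_mem_of_mem hG hB' ha.ne hvB haB hvB' hw
  exact hall x (this ▸ hxB') hx.ne'

lemma IsAdmissible.even_length {c : V → Bool} (hc : IsAdmissible T c) {u v : V} (hu : IsLeaf T u)
    (hv : IsLeaf T v) (p : T.Walk u v) : Even p.length := by
  have := (Coloring.mk c fun {a b} h => hc.1 a b h : T.Coloring Bool).even_length_iff_congr p
  exact this.2 ⟨fun _ => hc.2 v hv, fun _ => hc.2 u hu⟩

lemma IsGoodColoring.isSpanningEvenTree [Finite V] (hG : IsBlockGraph G) {c : V → Bool}
    (h : IsGoodColoring G c) (hTG : T ≤ G) (hT : T.IsTree)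
    (hTc : ∀ u v, T.Adj u v → c u ≠ c v) : IsSpanningEvenTree G T := by
  have hadm : IsAdmissible T c :=
    ⟨hTc, fun v hv => h.leaf_of_connected hG hTG hT.connected hTc hv⟩
  exact ⟨hTG, hT, fun u v hu hv _ p _ => hadm.even_length hu hv p⟩

/-- Coloring the vertices of an even tree by the parity of the distance to a leaf is admissible. -/
lemma IsEvenTree.exists_isAdmissible (h : IsEvenTree T) : ∃ c : V → Bool, IsAdmissible T c := by
  classical
  have key : ∃ r, ∀ v, IsLeaf T v → IsLeaf T r := by
    by_cases hl : ∃ r, IsLeaf T r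
    · obtain ⟨r, hr⟩ := hl
      exact ⟨r, fun _ _ => hr⟩
    · obtain ⟨r⟩ := h.1.connected.nonempty
      exact ⟨r, fun v hv => absurd ⟨v, hv⟩ hl⟩
  obtain ⟨r, hr⟩ := key
  refine ⟨fun v => decide (Even (T.dist r v)), fun u v huv => ?_, fun v hv => ?_⟩
  · rcases h.1.dist_eq_dist_add_one_of_adj r huv with e | e <;>
      simp [e, Nat.even_add_one, -Nat.not_even_iff_odd]
  · by_cases e : r = v
    · simp [e]
    · obtain ⟨p, hp, hl⟩ := h.1.connected.exists_path_of_dist r v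
      simpa [hl] using h.2 r v (hr v hv) hv e p hp

/-! ### Forced colors -/

lemma IsLeaf.of_le [Nontrivial V] (hTG : T ≤ G) (hT : T.Connected) {v : V} (hv : IsLeaf G v) :
    IsLeaf T v := by
  obtain ⟨a, ha⟩ := hT.preconnected.exists_adj_of_nontrivial v
  exact isLeaf_of_unique_adj ha fun b hb => hv.eq_of_adj (hTG hb) (hTG ha)

/-- An admissible coloring of a spanning tree of a block graph is not constant on a maximal
clique with at least two vertices. -/
lemma IsMaximalClique.exists_ne_of_isAdmissible [Finite V] (hG : IsBlockGraph G)
    (hB : IsMaximalClique G B) (hT : IsSpanningEvenTree G T) {c : V → Bool}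
    (hc : IsAdmissible T c) {u v : V} (hu : u ∈ B) (hv : v ∈ B) (huv : u ≠ v) :
    ∃ w ∈ B, c w ≠ c u := by
  obtain ⟨w, hw, huw⟩ := hB.exists_adj_of_connected hG hT.1 hT.2.1.connected hu hv huv
  exact ⟨w, hw, (hc.1 _ _ huw).symm⟩

/-- If an admissible coloring of a spanning even tree has the color `b` on all vertices of a
maximal clique but `v`, then it has the other color at `v`. -/
lemma IsMaximalClique.eq_not_of_isAdmissible [Finite V] (hG : IsBlockGraph G)
    (hB : IsMaximalClique G B) (hT : IsSpanningEvenTree G T) {c : V → Bool}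
    (hc : IsAdmissible T c) {u v : V} (hu : u ∈ B) (hv : v ∈ B) (huv : u ≠ v) {b : Bool}
    (hb : ∀ w ∈ B, w ≠ v → c w = b) : c v = !b := by
  obtain ⟨w, hw, hwu⟩ := hB.exists_ne_of_isAdmissible hG hT hc hu hv huv
  rw [hb u hu huv] at hwu
  by_cases e : w = v
  · subst e; exact Bool.eq_not_of_ne hwu
  · exact absurd (hb w hw e) hwu

end BlockGraphs

section ForcedColoring

variable {V : Type*} {G T : SimpleGraph V} {c c' c₁ c₂ : V → Option Bool}

/-- What the color propagation guarantees about a partial coloring `c`: its colors are those of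
every admissible coloring of a spanning even tree, leaves are black, and each white vertex is the
only vertex of some maximal clique that is not black. -/
structure IsForcedInvariant (G : SimpleGraph V) (c : V → Option Bool) : Prop where
  agrees : ∀ (T : SimpleGraph V) (d : V → Bool), IsSpanningEvenTree G T → IsAdmissible T d →
    ∀ (v : V) (b : Bool), c v = some b → d v = b
  leaf : ∀ v, IsLeaf G v → c v = some true
  white : ∀ v, c v = some false →
    ∃ B, IsMaximalClique G B ∧ v ∈ B ∧ ∀ u ∈ B, u ≠ v → c u = some true

lemma isForcedInvariant_initialColoring :
    IsForcedInvariant G (initialColoring G) where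
  agrees T d hT hd v b hv := by
    unfold initialColoring at hv
    split_ifs at hv with hl
    cases hv
    obtain ⟨a, ha⟩ := hl.exists_adj
    have : Nontrivial V := ⟨v, a, ha.ne⟩
    exact hd.2 v (hl.of_le hT.1 hT.2.1.connected)
  leaf v hv := by simp [initialColoring, hv]
  white v hv := by
    unfold initialColoring at hv
    split_ifs at hv with hl
    cases hv

lemma IsForcedInvariant.forceStep [Finite V] [Nontrivial V] (hG : IsBlockGraph G)
    (hc : G.Connected) (h : IsForcedInvariant G c) (hs : ForceStep G c c') :
    IsForcedInvariant G c' := by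
  classical
  obtain ⟨B, hB, v, hv, hcv, b, hb, rfl⟩ := hs
  have hne : ∀ {w x}, c w = some x → w ≠ v := by rintro w x hw rfl; simp [hcv] at hw
  obtain ⟨u, hu, huv⟩ := hB.exists_ne hc v
  refine ⟨fun T d hT hd w x hw => ?_, fun w hw => ?_, fun w hw => ?_⟩
  · by_cases hwv : w = v
    · subst hwv
      simp only [Function.update_self, Option.some.injEq] at hw
      rw [← hw]
      exact hB.eq_not_of_isAdmissible hG hT hd hu hv huv
        fun y hy hyw => h.agrees T d hT hd y b (hb y hy hyw)
    · exact h.agrees T d hT hd w x (by simpa [hwv] using hw)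
  · simp [hne (h.leaf w hw), h.leaf w hw]
  · by_cases hwv : w = v
    · subst hwv
      simp only [Function.update_self, Option.some.injEq, Bool.not_eq_false'] at hw
      subst hw
      exact ⟨B, hB, hv, fun y hy hyw => by simpa [hyw] using hb y hy hyw⟩
    · obtain ⟨C, hC, hwC, hCb⟩ := h.white w (by simpa [hwv] using hw)
      refine ⟨C, hC, hwC, fun y hy hyw => ?_⟩
      have := hCb y hy hyw
      simpa [hne this] using this

lemma IsForcedColoring.isForcedInvariant [Finite V] [Nontrivial V] (hG : IsBlockGraph G)
    (hc : G.Connected) (h : IsForcedColoring G c) : IsForcedInvariant G c := by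
  have key : ∀ d, Relation.ReflTransGen (ForceStep G) (initialColoring G) d →
      IsForcedInvariant G d := by
    intro d hd
    induction hd with
    | refl => exact isForcedInvariant_initialColoring
    | tail _ hs ih => exact ih.forceStep hG hc hs
  exact key c h.1

/-- A spanning even tree has only edges that survive the deletion of monochromatic edges. -/
lemma IsForcedInvariant.connected_bichromatic (h : IsForcedInvariant G c)
    (hT : IsSpanningEvenTree G T) : (bichromatic G c).Connected := by
  obtain ⟨d, hd⟩ := hT.2.exists_isAdmissible
  refine hT.2.1.connected.mono fun u v huv => ⟨hT.1 huv, fun ⟨b, hu, hv⟩ => hd.1 _ _ huv ?_⟩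
  rw [h.agrees T d hT hd u b hu, h.agrees T d hT hd v b hv]

lemma bichromatic_le : bichromatic G c ≤ G := fun _ _ h => h.1

/-- A step that only colors uncolored vertices, and at least one of them, cannot be repeated
forever. -/
lemma wellFounded_of_extends [Finite V] {R : (V → Option Bool) → (V → Option Bool) → Prop}
    (hR : ∀ c c', R c c' → (∀ v b, c v = some b → c' v = some b) ∧ ∃ v, c v = none ∧ c' v ≠ none) :
    WellFounded fun c' c => R c c' := by
  refine Subrelation.wf (r := InvImage (· < ·) fun c : V → Option Bool => {v | c v = none}.ncard)
    (fun {c' c} h => ?_) (InvImage.wf _ Nat.lt_wfRel.wf)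
  obtain ⟨h1, v, hv, hv'⟩ := hR c c' h
  refine Set.ncard_lt_ncard ⟨fun w hw => ?_, fun hs => hv' (hs hv)⟩ (Set.toFinite _)
  cases e : c w with
  | none => exact e
  | some b => exact absurd (h1 w b e) (by simp [show c' w = none from hw])

lemma wellFounded_forceStep [Finite V] : WellFounded fun c' c => ForceStep G c c' := by
  classical
  refine wellFounded_of_extends ?_
  rintro c c' ⟨B, hB, v, hv, hcv, b, hb, rfl⟩
  refine ⟨fun w x hw => ?_, v, hcv, by simp⟩
  rw [Function.update_of_ne, hw]
  rintro rfl
  simp [hcv] at hw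

/-! ### Filling a clique -/

variable {B : Set V} {v w : V} {b : Bool}

lemma fillClique_of_eq_some (h : c w = some b) : fillClique c B v w = some b := by
  simp [fillClique, h]

lemma fillClique_of_notMem (h : w ∉ B) : fillClique c B v w = c w := by
  simp [fillClique, h]

lemma fillClique_ne_none (h : w ∈ B) : fillClique c B v w ≠ none := by
  unfold fillClique
  split_ifs with h1 h2
  · simp
  · simp
  · exact fun hw => h1 ⟨h, hw⟩

/-- A white vertex that was not white before filling `B` is the only white vertex of `B`. -/
lemma eq_some_true_of_fillClique (hc : c w ≠ some false) (hw : fillClique c B v w = some false) :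
    w ∈ B ∧ ∀ u ∈ B, u ≠ w → fillClique c B v u = some true := by
  unfold fillClique at hw
  split_ifs at hw with h1 h2
  · refine ⟨h1.1, fun u hu huw => ?_⟩
    rw [h2.1] at huw
    unfold fillClique
    split_ifs with h3 h4
    · exact absurd h4.1 huw
    · rfl
    · cases e : c u with
      | none => exact absurd ⟨hu, e⟩ h3
      | some b => cases b with
        | true => rfl
        | false => exact absurd e (h2.2 u hu)
  · cases hw
  · exact absurd hw hc

/-- Filling a clique makes it bichromatic. -/
lemma exists_of_fillClique (hv : v ∈ B) (hcv : c v = none) (hB : ∃ u ∈ B, u ≠ v) :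
    (∃ u ∈ B, fillClique c B v u = some true) ∧ ∃ u ∈ B, fillClique c B v u = some false := by
  by_cases hw : ∃ u ∈ B, c u = some false
  · refine ⟨⟨v, hv, ?_⟩, ?_⟩
    · obtain ⟨u, hu, hcu⟩ := hw
      unfold fillClique
      rw [if_pos ⟨hv, hcv⟩, if_neg fun h => h.2 u hu hcu]
    · obtain ⟨u, hu, hcu⟩ := hw
      exact ⟨u, hu, fillClique_of_eq_some hcu⟩
  · have hvf : fillClique c B v v = some false := by
      unfold fillClique
      rw [if_pos ⟨hv, hcv⟩, if_pos ⟨rfl, fun u hu hcu => hw ⟨u, hu, hcu⟩⟩]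
    obtain ⟨u, hu, huv⟩ := hB
    exact ⟨⟨u, hu, (eq_some_true_of_fillClique (by simp [hcv]) hvf).2 u hu huv⟩, v, hv, hvf⟩

lemma wellFounded_topDownStep [Finite V] (r : BlockCutNode G) :
    WellFounded fun c' c => TopDownStep G r c c' := by
  refine wellFounded_of_extends ?_
  rintro c c' ⟨B, -, v, hv, hcv, rfl⟩
  exact ⟨fun w x hw => fillClique_of_eq_some hw, v, hcv, fillClique_ne_none hv⟩

/-! ### Ancestors in the block-cut tree -/

/-- The vertices that a node of the block-cut tree consists of. -/
def nodeVertices : BlockCutNode G → Set V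
  | .inl B => B.1
  | .inr c => {c.1}

/-- The graph without the edges inside of `B`. -/
def outside (G : SimpleGraph V) (B : Set V) : SimpleGraph V where
  Adj u v := G.Adj u v ∧ ¬ (u ∈ B ∧ v ∈ B)
  symm := ⟨fun _ _ h => ⟨h.1.symm, fun h' => h.2 h'.symm⟩⟩
  loopless := ⟨fun v h => G.loopless.irrefl v h.1⟩

/-- Without the edges of a maximal clique `B` its vertices lie in distinct components. -/
lemma IsMaximalClique.eq_of_reachable_outside [Finite V] (hG : IsBlockGraph G)
    (hB : IsMaximalClique G B) {u v : V} (hu : u ∈ B) (hv : v ∈ B)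
    (h : (outside G B).Reachable u v) : u = v := by
  obtain ⟨p, hp⟩ := h.exists_isPath
  have hle : outside G B ≤ G := fun _ _ h => h.1
  cases p with
  | nil => rfl
  | cons h q =>
    refine absurd ⟨hu, ?_⟩ h.2
    exact hB.mem_of_mem_support hG hu hv (hp.mapLe hle) (by simp)

lemma reachable_outside_of_walk [Finite V] (hG : IsBlockGraph G) (hB : IsMaximalClique G B)
    {x y : BlockCutNode G} (q : (blockCutTree G).Walk x y) (hq : .inl ⟨B, hB⟩ ∉ q.support)
    {a b : V} (ha : a ∈ nodeVertices x) (hb : b ∈ nodeVertices y) :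
    (outside G B).Reachable a b := by
  have clique : ∀ C : {C // IsMaximalClique G C}, .inl C ≠ (.inl ⟨B, hB⟩ : BlockCutNode G) →
      ∀ a ∈ C.1, ∀ b ∈ C.1, (outside G B).Reachable a b := by
    intro C hC a ha b hb
    by_cases hab : a = b
    · exact hab ▸ Reachable.refl _
    · refine Adj.reachable ⟨C.2.1 ha hb hab, fun h => hC ?_⟩
      rw [Sum.inl.injEq, Subtype.ext_iff]
      exact C.2.eq_of_mem_of_mem hG hB hab ha hb h.1 h.2
  induction q generalizing a with
  | nil =>
    rename_i x
    rcases x with C | c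
    · exact clique C (by simpa [eq_comm] using hq) a ha b hb
    · rw [Set.mem_singleton_iff.1 ha, Set.mem_singleton_iff.1 hb]
  | @cons x z y h q ih =>
    simp only [Walk.support_cons, List.mem_cons, not_or] at hq
    rcases x with C | c <;> rcases z with C' | c'
    · exact h.elim
    · exact (clique C (Ne.symm hq.1) a ha c'.1 h).trans (ih hq.2 (Set.mem_singleton _) hb)
    · rw [Set.mem_singleton_iff.1 ha]
      exact ih hq.2 h hb
    · exact h.elim

/-- If two maximal cliques that meet `B` are not below `B`, then they meet `B` in the same vertex,
the parent of `B`. -/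
lemma eq_of_not_isAncestor [Finite V] (hG : IsBlockGraph G) {r : BlockCutNode G}
    {B B₁ B₂ : {B // IsMaximalClique G B}}
    (h₁ : ¬ IsAncestor (blockCutTree G) r (.inl B) (.inl B₁))
    (h₂ : ¬ IsAncestor (blockCutTree G) r (.inl B) (.inl B₂)) {u₁ u₂ : V}
    (hu₁ : u₁ ∈ B.1) (hu₁' : u₁ ∈ B₁.1) (hu₂ : u₂ ∈ B.1) (hu₂' : u₂ ∈ B₂.1) : u₁ = u₂ := by
  unfold IsAncestor at h₁ h₂
  push Not at h₁ h₂
  obtain ⟨p₁, -, hp₁⟩ := h₁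
  obtain ⟨p₂, -, hp₂⟩ := h₂
  refine B.2.eq_of_reachable_outside hG hu₁ hu₂
    (reachable_outside_of_walk hG B.2 (p₁.reverse.append p₂) ?_
      (show u₁ ∈ nodeVertices (.inl B₁) from hu₁') (show u₂ ∈ nodeVertices (.inl B₂) from hu₂'))
  simp [Walk.mem_support_append_iff, hp₁, hp₂]

/-- A vertex in two maximal cliques is a cut vertex. -/
lemma isCutVertex_of_mem_of_mem [Finite V] [Nontrivial V] (hG : IsBlockGraph G)
    (hc : G.Connected) {B B' : Set V} (hB : IsMaximalClique G B) (hB' : IsMaximalClique G B')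
    (hne : B ≠ B') {u : V} (hu : u ∈ B) (hu' : u ∈ B') : IsCutVertex G u := by
  obtain ⟨x, hx, hxu⟩ := hB.exists_ne hc u
  obtain ⟨y, hy, hyu⟩ := hB'.exists_ne hc u
  refine ⟨x, y, hxu, hyu, hc.preconnected x y, fun h => ?_⟩
  obtain ⟨p, hp⟩ := h.exists_isPath
  have hle := G.deleteIncidenceSet_le u
  -- No vertex of a walk that avoids the edges at `u` is `u`, except perhaps its ends.
  have havoid : ∀ {a b : V} (q : (G.deleteIncidenceSet u).Walk a b), b ≠ u → u ∉ q.support := by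
    intro a b q hb
    induction q with
    | nil => simpa using hb.symm
    | cons h q ih =>
      rw [deleteIncidenceSet_adj] at h
      simpa [h.2.1.symm] using ih hb
  have hp' : ((p.mapLe hle).concat (hB'.1 hy hu' hyu)).IsPath :=
    (hp.mapLe hle).concat (by simpa using havoid p hyu) _
  have hyB : y ∈ B := hB.mem_of_mem_support hG hx hu hp' (by simp [Walk.support_concat])
  exact hne (hB.eq_of_mem_of_mem hG hB' hyu hyB hu hy hu')

lemma reachable_blockCutTree_of_walk [Finite V] [Nontrivial V] (hG : IsBlockGraph G)
    (hc : G.Connected) {u v : V} (p : G.Walk u v) (B B' : {B // IsMaximalClique G B})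
    (hu : u ∈ B.1) (hv : v ∈ B'.1) : (blockCutTree G).Reachable (.inl B) (.inl B') := by
  have key : ∀ (B B' : {B // IsMaximalClique G B}) (u : V), u ∈ B.1 → u ∈ B'.1 →
      (blockCutTree G).Reachable (.inl B) (.inl B') := by
    intro B B' u hu hu'
    by_cases e : B = B'
    · exact e ▸ Reachable.refl _
    · have hcut := isCutVertex_of_mem_of_mem hG hc B.2 B'.2 (fun h => e (Subtype.ext h)) hu hu'
      have h1 : (blockCutTree G).Adj (.inl B) (.inr ⟨u, hcut⟩) := hu
      have h2 : (blockCutTree G).Adj (.inr ⟨u, hcut⟩) (.inl B') := hu'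
      exact h1.reachable.trans h2.reachable
  induction p generalizing B with
  | nil => exact key B B' _ hu hv
  | cons h q ih =>
    obtain ⟨C, hC, h1, h2⟩ := exists_isMaximalClique_of_adj h
    exact (key B ⟨C, hC⟩ _ hu h1).trans (ih ⟨C, hC⟩ h2 hv)

lemma reachable_blockCutTree [Finite V] [Nontrivial V] (hG : IsBlockGraph G)
    (hc : G.Connected) (r : BlockCutNode G) (B : {B // IsMaximalClique G B}) :
    (blockCutTree G).Reachable r (.inl B) := by
  have key : ∀ B' : {B // IsMaximalClique G B},
      (blockCutTree G).Reachable (.inl B') (.inl B) := by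
    intro B'
    obtain ⟨v⟩ := hc.nonempty
    obtain ⟨x, hx, -⟩ := B'.2.exists_ne hc v
    obtain ⟨y, hy, -⟩ := B.2.exists_ne hc v
    obtain ⟨p⟩ := hc.preconnected x y
    exact reachable_blockCutTree_of_walk hG hc p B' B hx hy
  rcases r with B' | u
  · exact key B'
  · obtain ⟨C, hC, hu⟩ := exists_isMaximalClique (G := G) (C := {u.1}) (by simp)
    have h1 : (blockCutTree G).Adj (.inr u) (.inl ⟨C, hC⟩) := hu rfl
    exact h1.reachable.trans (key _)

/-! ### The top-down coloring -/

/-- As long as some vertex is uncolored, a top-down step is possible: it can be performed at a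
clique that is closest to the root among those with uncolored vertices. -/
lemma exists_topDownStep [Finite V] [Nontrivial V] (hG : IsBlockGraph G) (hc : G.Connected)
    (r : BlockCutNode G) {v : V} (hv : c v = none) : ∃ c', TopDownStep G r c c' := by
  classical
  obtain ⟨B₀, hB₀, hv₀⟩ := exists_isMaximalClique (G := G) (C := {v}) (by simp)
  obtain ⟨B, ⟨w, hw, hcw⟩, hmin⟩ := Set.exists_min_image
    {B : {B // IsMaximalClique G B} | ∃ w ∈ B.1, c w = none}
    (fun B => (blockCutTree G).dist r (.inl B)) (Set.toFinite _) ⟨⟨B₀, hB₀⟩, v, hv₀ rfl, hv⟩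
  refine ⟨_, B, fun B' hanc hne u hu hcu => ?_, w, hw, hcw, rfl⟩
  obtain ⟨p, hp, hl⟩ := (reachable_blockCutTree hG hc r B).exists_path_of_dist
  have hmem := hanc p hp
  have h1 := hmin B' ⟨u, hu, hcu⟩
  have h2 := dist_le (p.takeUntil _ hmem)
  have h3 := p.length_takeUntil_lt_length hmem (fun e => hne (Sum.inl.inj e))
  omega

/-- What the top-down coloring preserves. In a clique with an uncolored vertex only the parent may
have been colored since the start; so a clique that is completed by the coloring of other cliques
had just its parent uncolored at the start, and was bichromatic already. -/
structure IsTopDownInvariant (G : SimpleGraph V) (r : BlockCutNode G) (c₁ c : V → Option Bool) :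
    Prop where
  extends_start : ∀ v b, c₁ v = some b → c v = some b
  parent : ∀ B : {B // IsMaximalClique G B}, (∃ x ∈ B.1, c x = none) →
    ∀ u ∈ B.1, c u ≠ none → c₁ u = none → ∃ B' : {B // IsMaximalClique G B}, u ∈ B'.1 ∧
      ¬ IsAncestor (blockCutTree G) r (.inl B) (.inl B')
  bichromatic : ∀ B, IsMaximalClique G B → (∀ x ∈ B, c x ≠ none) →
    (∃ u ∈ B, c u = some true) ∧ ∃ u ∈ B, c u = some false
  white : ∀ v, c v = some false →
    ∃ B, IsMaximalClique G B ∧ v ∈ B ∧ ∀ u ∈ B, u ≠ v → c u = some true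

lemma exists_both_of_exists_ne {S : Set V} (hS : ∀ x ∈ S, c x ≠ none)
    (h : ∀ b, ¬ ∀ x ∈ S, c x = some b) :
    (∃ u ∈ S, c u = some true) ∧ ∃ u ∈ S, c u = some false := by
  have key : ∀ b, ∃ u ∈ S, c u = some b := by
    intro b
    have := h (!b)
    push Not at this
    obtain ⟨u, hu, hcu⟩ := this
    refine ⟨u, hu, ?_⟩
    cases e : c u with
    | none => exact absurd e (hS u hu)
    | some d => cases b <;> cases d <;> simp_all
  exact ⟨key true, key false⟩

lemma isTopDownInvariant_start [Finite V] [Nontrivial V] (hG : IsBlockGraph G)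
    (hc : G.Connected) (r : BlockCutNode G) (h : IsForcedInvariant G c₁)
    (hcon : (bichromatic G c₁).Connected) : IsTopDownInvariant G r c₁ c₁ where
  extends_start _ _ h := h
  parent _ _ u _ h1 h2 := absurd h2 h1
  bichromatic B hB hcol := by
    obtain ⟨v⟩ := hc.nonempty
    obtain ⟨x, hx, -⟩ := hB.exists_ne hc v
    obtain ⟨y, hy, hyx⟩ := hB.exists_ne hc x
    refine exists_both_of_exists_ne hcol fun b hb => ?_
    obtain ⟨w, hw, hxw⟩ := hB.exists_adj_of_connected hG bichromatic_le hcon hx hy hyx.symm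
    exact hxw.2 ⟨b, hb x hx, hb w hw⟩
  white := h.white

lemma IsTopDownInvariant.step [Finite V] [Nontrivial V] (hG : IsBlockGraph G)
    (hc : G.Connected) {r : BlockCutNode G} (hterm : ∀ c', ¬ ForceStep G c₁ c')
    (h : IsTopDownInvariant G r c₁ c) (hs : TopDownStep G r c c') :
    IsTopDownInvariant G r c₁ c' := by
  obtain ⟨B₀, hanc, v, hv, hcv, rfl⟩ := hs
  have hext : ∀ {w b}, c w = some b → fillClique c B₀.1 v w = some b := fillClique_of_eq_some
  have hnone : ∀ {w}, fillClique c B₀.1 v w = none → c w = none := by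
    intro w hw
    cases e : c w with
    | none => rfl
    | some b => rw [hext e] at hw; cases hw
  have hnew : ∀ {w}, c w = none → fillClique c B₀.1 v w ≠ none → w ∈ B₀.1 := by
    intro w hw hw'
    by_contra hmem
    exact hw' (by rw [fillClique_of_notMem hmem, hw])
  have hnotanc : ∀ B : {B // IsMaximalClique G B}, B ≠ B₀ → (∃ x ∈ B.1, c x = none) →
      ¬ IsAncestor (blockCutTree G) r (.inl B) (.inl B₀) :=
    fun B hne ⟨x, hx, hcx⟩ ha => hanc B ha hne x hx hcx
  refine ⟨fun w b hw => hext (h.extends_start w b hw), ?_, ?_, ?_⟩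
  · rintro B ⟨x, hx, hcx⟩ u hu hcu hcu₁
    have hne : B ≠ B₀ := by rintro rfl; exact fillClique_ne_none hx hcx
    by_cases e : c u = none
    · exact ⟨B₀, hnew e hcu, hnotanc B hne ⟨x, hx, hnone hcx⟩⟩
    · exact h.parent B ⟨x, hx, hnone hcx⟩ u hu e hcu₁
  · intro B hB hcol
    by_cases hfull : ∀ x ∈ B, c x ≠ none
    · obtain ⟨⟨a, ha, hca⟩, a', ha', hca'⟩ := h.bichromatic B hB hfull
      exact ⟨⟨a, ha, hext hca⟩, a', ha', hext hca'⟩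
    push Not at hfull
    obtain ⟨x, hx, hcx⟩ := hfull
    by_cases hBB₀ : (⟨B, hB⟩ : {B // IsMaximalClique G B}) = B₀
    · subst hBB₀
      exact exists_of_fillClique hv hcv (hB.exists_ne hc v)
    · -- `B` is completed by the coloring of `B₀`: its only uncolored vertex was `x`, which it
      -- shares with `B₀`; `x` was uncolored at the start too, and all others were colored then.
      have hxB₀ : x ∈ B₀.1 := hnew hcx (hcol x hx)
      have hna := hnotanc ⟨B, hB⟩ hBB₀ ⟨x, hx, hcx⟩
      have honly : ∀ u ∈ B, u ≠ x → c₁ u ≠ none := by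
        intro u hu hux hcu₁
        by_cases hcu : c u = none
        · exact hBB₀ (Subtype.ext (hB.eq_of_mem_of_mem hG B₀.2 hux hu hx
            (hnew hcu (hcol u hu)) hxB₀))
        · obtain ⟨B', huB', hB'⟩ := h.parent ⟨B, hB⟩ ⟨x, hx, hcx⟩ u hu hcu hcu₁
          exact hux (eq_of_not_isAncestor hG hB' hna hu huB' hx hxB₀)
      have hx₁ : c₁ x = none := by
        cases e : c₁ x with
        | none => rfl
        | some b => rw [h.extends_start x b e] at hcx; cases hcx
      obtain ⟨⟨a, ha, hca⟩, a', ha', hca'⟩ := exists_both_of_exists_ne (c := c₁)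
        (S := {u ∈ B | u ≠ x}) (fun u hu => honly u hu.1 hu.2)
        fun b hb => hterm _ ⟨B, hB, x, hx, hx₁, b, fun u hu hux => hb u ⟨hu, hux⟩, rfl⟩
      exact ⟨⟨a, ha.1, hext (h.extends_start _ _ hca)⟩, a', ha'.1,
        hext (h.extends_start _ _ hca')⟩
  · intro w hw
    by_cases hcw : c w = some false
    · obtain ⟨B, hB, hwB, hb⟩ := h.white w hcw
      exact ⟨B, hB, hwB, fun u hu huw => hext (hb u hu huw)⟩
    · have := eq_some_true_of_fillClique hcw hw
      exact ⟨B₀.1, B₀.2, this.1, this.2⟩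

lemma isTopDownInvariant_of_exhaust [Finite V] [Nontrivial V] (hG : IsBlockGraph G)
    (hc : G.Connected) {r : BlockCutNode G} (h₁ : IsForcedColoring G c₁)
    (hcon : (bichromatic G c₁).Connected) (h₂ : Exhaust (TopDownStep G r) c₁ c₂) :
    IsTopDownInvariant G r c₁ c₂ := by
  have key : ∀ d, Relation.ReflTransGen (TopDownStep G r) c₁ d → IsTopDownInvariant G r c₁ d := by
    intro d hd
    induction hd with
    | refl => exact isTopDownInvariant_start hG hc r (h₁.isForcedInvariant hG hc) hcon
    | tail _ hs ih => exact ih.step hG hc h₁.2 hs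
  exact key c₂ h₂.1

/-- The final coloring of the procedure is good. -/
lemma exists_isGoodColoring_of_exhaust [Finite V] [Nontrivial V] (hG : IsBlockGraph G)
    (hc : G.Connected) {r : BlockCutNode G} (h₁ : IsForcedColoring G c₁)
    (hcon : (bichromatic G c₁).Connected) (h₂ : Exhaust (TopDownStep G r) c₁ c₂) :
    ∃ d : V → Bool, (∀ v, c₂ v = some (d v)) ∧ (∀ v b, c₁ v = some b → d v = b) ∧
      IsGoodColoring G d := by
  have hinv := isTopDownInvariant_of_exhaust hG hc h₁ hcon h₂
  have htotal : ∀ v, ∃ b, c₂ v = some b := fun v => Option.ne_none_iff_exists'.1 fun hv =>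
    let ⟨c', hc'⟩ := exists_topDownStep hG hc r hv
    h₂.2 c' hc'
  choose d hd using htotal
  have hd₁ : ∀ v b, c₁ v = some b → d v = b := fun v b hv => by
    have := hinv.extends_start v b hv
    rw [hd] at this
    exact Option.some.inj this
  have hdb : ∀ {v b}, c₂ v = some b → d v = b := fun {v b} hv => by
    rw [hd] at hv
    exact Option.some.inj hv
  refine ⟨d, hd, hd₁, fun v hv => hd₁ v true ((h₁.isForcedInvariant hG hc).leaf v hv), ?_, ?_⟩
  · intro B hB u _ _ _ _
    obtain ⟨⟨a, ha, hca⟩, a', ha', hca'⟩ := hinv.bichromatic B hB fun x _ => by simp [hd]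
    cases e : d u
    · exact ⟨a, ha, by simp [hdb hca]⟩
    · exact ⟨a', ha', by simp [hdb hca']⟩
  · intro v hv
    obtain ⟨B, hB, hvB, hb⟩ := hinv.white v (by rw [hd, hv])
    exact ⟨B, hB, hvB, fun u hu huv => hdb (hb u hu huv)⟩

end ForcedColoring

/-- The coloring procedure is correct, whatever choices are made. -/
theorem coloring_procedure_correct {V : Type*} [Finite V] (G : SimpleGraph V)
    (hG : IsBlockGraph G) (hc : G.Connected) (hcard : 3 ≤ Nat.card V) :
    WellFounded (fun c' c => ForceStep G c c') ∧
    (∀ r : BlockCutNode G, WellFounded (fun c' c => TopDownStep G r c c')) ∧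
    ∀ c₁ : V → Option Bool, IsForcedColoring G c₁ →
      (∀ (T : SimpleGraph V) (c : V → Bool), IsSpanningEvenTree G T → IsAdmissible T c →
        ∀ (v : V) (b : Bool), c₁ v = some b → c v = b) ∧
      (¬ (bichromatic G c₁).Connected → ¬ ∃ T : SimpleGraph V, IsSpanningEvenTree G T) ∧
      ((bichromatic G c₁).Connected →
        ∀ (r : BlockCutNode G) (c₂ : V → Option Bool), Exhaust (TopDownStep G r) c₁ c₂ →
          (bichromatic (bichromatic G c₁) c₂).Connected ∧
          ∀ T : SimpleGraph V, T ≤ bichromatic (bichromatic G c₁) c₂ → T.IsTree →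
            IsSpanningEvenTree G T) := by
  have : Nontrivial V := Finite.one_lt_card_iff_nontrivial.1 (by omega)
  refine ⟨wellFounded_forceStep, wellFounded_topDownStep, fun c₁ h₁ => ?_⟩
  have hinv := h₁.isForcedInvariant hG hc
  refine ⟨hinv.agrees, fun hn ⟨_, hT⟩ => hn (hinv.connected_bichromatic hT),
    fun hcon r c₂ h₂ => ?_⟩
  obtain ⟨d, hd, hd₁, hgood⟩ := exists_isGoodColoring_of_exhaust hG hc h₁ hcon h₂
  refine ⟨hgood.connected hc fun u v huv hne => ⟨⟨huv, ?_⟩, ?_⟩, fun T hT hTt =>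
    hgood.isSpanningEvenTree hG (hT.trans (bichromatic_le.trans bichromatic_le)) hTt
      fun u v huv hne => (hT huv).2 ⟨d u, hd u, hne ▸ hd v⟩⟩
  · rintro ⟨b, hu, hv⟩
    exact hne (by rw [hd₁ u b hu, hd₁ v b hv])
  · rintro ⟨b, hu, hv⟩
    rw [hd] at hu hv
    exact hne (Option.some.inj (hu.trans hv.symm))

section SearchTree

variable {V : Type*} {G : SimpleGraph V} {root : V} {pos : V → ℕ} {p : V → V}

/-! ### Breadth-first search in block graphs -/

/-- A spanning tree found by breadth-first search: `pos` numbers the vertices in the order in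
which they are found, and the parent `p v` of a vertex `v` is its first neighbor. -/
structure IsSearchTree (G : SimpleGraph V) (root : V) (pos : V → ℕ) (p : V → V) : Prop where
  inj : Function.Injective pos
  adj : ∀ v, v ≠ root → G.Adj (p v) v
  lt : ∀ v, v ≠ root → pos (p v) < pos v
  le : ∀ v, v ≠ root → ∀ u, G.Adj u v → pos (p v) ≤ pos u

/-- `v` and `w` have the same parent and belong to the same clique with it. -/
def IsSibling (G : SimpleGraph V) (root : V) (p : V → V) (v w : V) : Prop :=
  w ≠ root ∧ p w = p v ∧ G.Adj v w

/-- The members of the clique in which `v` hangs below its parent. -/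
def UpClique (G : SimpleGraph V) (root : V) (p : V → V) (v : V) : Set V :=
  {w | w = p v ∨ w = v ∨ IsSibling G root p v w}

lemma IsSibling.symm {v w : V} (hv : v ≠ root) (hs : IsSibling G root p v w) :
    IsSibling G root p w v := ⟨hv, hs.2.1.symm, hs.2.2.symm⟩

namespace IsSearchTree

variable (h : IsSearchTree G root pos p)
include h

/-- Two vertices are joined by a walk through ancestors, none of which comes after them. -/
lemma exists_walk (m : ℕ) : ∀ v w, pos v ≤ m → pos w ≤ m →
    ∃ q : G.Walk v w, ∀ x ∈ q.support, pos x ≤ m := by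
  have key : ∀ k v, pos v = k → k ≤ m → ∃ q : G.Walk v root, ∀ x ∈ q.support, pos x ≤ m := by
    intro k
    induction k using Nat.strong_induction_on with
    | _ k ih =>
      intro v hv hk
      by_cases hr : v = root
      · subst hr; exact ⟨.nil, by simp [hv, hk]⟩
      · have hlt := h.lt v hr
        obtain ⟨q, hq⟩ := ih _ (hv ▸ hlt) (p v) rfl (by omega)
        refine ⟨.cons (h.adj v hr).symm q, fun x hx => ?_⟩
        rw [Walk.support_cons, List.mem_cons] at hx
        rcases hx with rfl | hx
        · omega
        · exact hq x hx
  intro v w hv hw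
  obtain ⟨q, hq⟩ := key _ v rfl hv
  obtain ⟨q', hq'⟩ := key _ w rfl hw
  refine ⟨q.append q'.reverse, fun x hx => ?_⟩
  rw [Walk.mem_support_append_iff] at hx
  rcases hx with hx | hx
  · exact hq x hx
  · exact hq' x (by simpa using hx)

lemma root_lt {v : V} (hv : v ≠ root) : pos root < pos v := by
  have key : ∀ k v, pos v = k → v ≠ root → pos root < k := by
    intro k
    induction k using Nat.strong_induction_on with
    | _ k ih =>
      intro v hv hr
      have hlt := h.lt v hr
      by_cases hp : p v = root
      · rw [hp] at hlt; omega
      · exact (ih _ (hv ▸ hlt) _ rfl hp).trans (hv ▸ hlt)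
  exact key _ v rfl hv

lemma connected : G.Connected :=
  (connected_iff _).2 ⟨fun v w => (h.exists_walk (max (pos v) (pos w)) v w (le_max_left _ _)
    (le_max_right _ _)).elim fun q _ => q.reachable, ⟨root⟩⟩

/-- If `a` precedes `u`, both precede `v`, and `v` is adjacent to both `a` and `u`, then the
triangle closes: the search tree joins `u` to `a` without using `v`. -/
lemma mem_of_adj [Finite V] (hG : IsBlockGraph G) {B : Set V} (hB : IsMaximalClique G B)
    {u v a : V} (hu : u ∈ B) (hv : v ∈ B) (huv : pos u < pos v) (hav : G.Adj a v)
    (ha : pos a < pos v) : a ∈ B := by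
  classical
  obtain ⟨q, hq⟩ := h.exists_walk (pos v - 1) u a (by omega) (by omega)
  have hvq : v ∉ q.bypass.support := fun hx => by
    have := hq v (q.support_bypass_subset_support hx)
    omega
  exact hB.mem_of_mem_support hG hu hv (q.bypass_isPath.concat hvq hav)
    (by simp [Walk.support_concat])

/-- Each edge of a block graph joins a parent and its child or two siblings. -/
lemma eq_or_eq_of_adj [Finite V] (hG : IsBlockGraph G) {u v : V} (huv : G.Adj u v)
    (hlt : pos u < pos v) : u = p v ∨ (u ≠ root ∧ p u = p v) := by
  have hv : v ≠ root := by
    rintro rfl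
    have : u ≠ v := huv.ne
    have := h.root_lt this
    omega
  by_cases hu : u = p v
  · exact .inl hu
  have hle := h.le v hv u huv
  have hlt' : pos (p v) < pos u := lt_of_le_of_ne hle fun e => hu (h.inj e).symm
  have hur : u ≠ root := by
    rintro rfl
    by_cases e : p v = u
    · rw [e] at hlt'; omega
    · have := h.root_lt e; omega
  refine .inr ⟨hur, ?_⟩
  obtain ⟨B, hB, huB, hvB⟩ := exists_isMaximalClique_of_adj huv
  have hpv : p v ∈ B := h.mem_of_adj hG hB huB hvB hlt (h.adj v hv) (by omega)
  have hle' := h.le u hur _ (hB.1 hpv huB (Ne.symm hu))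
  refine h.inj (le_antisymm hle' ?_)
  have hpu : p u ∈ B := h.mem_of_adj hG hB hpv huB hlt' (h.adj u hur) (h.lt u hur)
  refine h.le v hv _ (hB.1 hpu hvB fun e => ?_)
  rw [e] at hle'
  omega

/-- The vertices that hang together below a parent form a maximal clique with it. -/
lemma isMaximalClique_upClique [Finite V] (hG : IsBlockGraph G) {v : V} (hv : v ≠ root) :
    IsMaximalClique G (UpClique G root p v) := by
  obtain ⟨B, hB, hpB, hvB⟩ := exists_isMaximalClique_of_adj (h.adj v hv)
  suffices hs : UpClique G root p v = B from hs ▸ hB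
  ext w
  constructor
  · rintro (rfl | rfl | ⟨hw, hpw, hvw⟩)
    · exact hpB
    · exact hvB
    · exact hB.mem_of_adj_adj hG hpB hvB (h.adj v hv).ne (hpw ▸ h.adj w hw) hvw.symm
  · intro hw
    by_cases hwv : w = v
    · exact .inr (.inl hwv)
    have hadj := hB.1 hw hvB hwv
    rcases lt_trichotomy (pos w) (pos v) with hlt | heq | hlt
    · rcases h.eq_or_eq_of_adj hG hadj hlt with e | ⟨hr, e⟩
      · exact .inl e
      · exact .inr (.inr ⟨hr, e, hadj.symm⟩)
    · exact absurd (h.inj heq) hwv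
    · rcases h.eq_or_eq_of_adj hG hadj.symm hlt with e | ⟨hr, e⟩
      · have hpw : p v ≠ w := fun e' => by
          have := h.lt v hv
          rw [e'] at this
          omega
        have hwr : w ≠ root := by
          rintro rfl
          have := h.root_lt hv
          omega
        have := h.le w hwr _ (hB.1 hpB hw hpw)
        have := h.lt v hv
        rw [← e] at *
        omega
      · have hwr : w ≠ root := by
          rintro rfl
          have := h.root_lt hv
          omega
        exact .inr (.inr ⟨hwr, e.symm, hadj.symm⟩)

/-- Each maximal clique with two vertices hangs below its first vertex. -/
lemma exists_eq_upClique [Finite V] (hG : IsBlockGraph G) {B : Set V}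
    (hB : IsMaximalClique G B) {x y : V} (hx : x ∈ B) (hy : y ∈ B) (hxy : x ≠ y) :
    ∃ v, v ≠ root ∧ B = UpClique G root p v ∧ ∀ w, IsSibling G root p v w → pos v ≤ pos w := by
  obtain ⟨u, hu, humin⟩ := Set.exists_min_image B pos (Set.toFinite _) ⟨x, hx⟩
  have hne : (B \ {u}).Nonempty := by
    by_cases e : x = u
    · exact ⟨y, hy, fun e' => hxy (e.trans e'.symm)⟩
    · exact ⟨x, hx, e⟩
  obtain ⟨v, ⟨hv, hvu⟩, hvmin⟩ := Set.exists_min_image (B \ {u}) pos (Set.toFinite _) hne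
  have hvu : v ≠ u := hvu
  have hlt : pos u < pos v := lt_of_le_of_ne (humin v hv) fun e => hvu (h.inj e).symm
  have hvr : v ≠ root := by
    rintro rfl
    have := h.root_lt (Ne.symm hvu)
    omega
  have hpB : p v ∈ B := h.mem_of_adj hG hB hu hv hlt (h.adj v hvr) (h.lt v hvr)
  have hup := h.isMaximalClique_upClique hG hvr
  have hpu : p v = u := by
    have := h.le v hvr u (hB.1 hu hv (Ne.symm hvu))
    have := humin _ hpB
    exact h.inj (by omega)
  have hBe : B = UpClique G root p v :=
    hB.eq_of_mem_of_mem hG hup (h.adj v hvr).ne hpB hv (.inl rfl) (.inr (.inl rfl))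
  refine ⟨v, hvr, hBe, fun w hw => hvmin w ⟨?_, fun e => ?_⟩⟩
  · rw [hBe]; exact .inr (.inr hw)
  · have e : w = u := e
    have := h.lt w hw.1
    rw [hw.2.1, hpu, e] at this
    omega

/-- Siblings span the same clique. -/
lemma isSibling_trans [Finite V] (hG : IsBlockGraph G) {u v w : V} (hv : v ≠ root)
    (hu : IsSibling G root p v u) (hw : IsSibling G root p v w) (huw : u ≠ w) :
    IsSibling G root p u w :=
  ⟨hw.1, hw.2.1.trans hu.2.1.symm,
    (h.isMaximalClique_upClique hG hv).1 (.inr (.inr hu)) (.inr (.inr hw)) huw⟩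

end IsSearchTree

end SearchTree

section SearchTreeColoring

variable {V : Type*} {G : SimpleGraph V} {root : V} {pos : V → ℕ} {p : V → V}
  {c c' c₁ : V → Option Bool}

/-! ### The two coloring passes along a search tree -/

/-- The bottom-up pass is done with the vertices from position `i` on: if such a vertex `v` is the
first of its siblings, and they all have the same color, then their parent has the other color. -/
def IsForcedFrom (G : SimpleGraph V) (root : V) (pos : V → ℕ) (p : V → V) (i : ℕ)
    (c : V → Option Bool) : Prop :=
  ∀ v, v ≠ root → i ≤ pos v → (∀ w, IsSibling G root p v w → pos v ≤ pos w) → ∀ b,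
    c v = some b → (∀ w, IsSibling G root p v w → c w = some b) → c (p v) = some (!b)

/-- The top-down pass is done with the vertices before position `i`: each of them that was
uncolored is white if and only if no other vertex of the clique above it is white. -/
structure IsFilledBelow (G : SimpleGraph V) (root : V) (pos : V → ℕ) (p : V → V)
    (c₁ : V → Option Bool) (i : ℕ) (c : V → Option Bool) : Prop where
  extends_start : ∀ v b, c₁ v = some b → c v = some b
  pending : ∀ v, i ≤ pos v → c v = c₁ v
  done : ∀ v, pos v < i → c v ≠ none
  root_black : c₁ root = none → c root ≠ some false
  rule : ∀ v, v ≠ root → pos v < i → c₁ v = none →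
    (c v = some false ↔ c (p v) ≠ some false ∧ ∀ w, IsSibling G root p v w → c w ≠ some false)

lemma IsForcedFrom.step {i : ℕ} (h : IsForcedFrom G root pos p (i + 1) c)
    (hinj : Function.Injective pos) {v : V} (hv : pos v = i)
    (hsame : ∀ w, i ≤ pos w → c' w = c w) (hext : ∀ w b, c w = some b → c' w = some b)
    (hclose : ∀ b, c v = some b → (∀ w, IsSibling G root p v w → c w = some b) →
      c' (p v) = some (!b)) : IsForcedFrom G root pos p i c' := by
  intro u hu hi hmin b hub hsib
  rw [hsame u hi] at hub
  have hsib' : ∀ w, IsSibling G root p u w → c w = some b := fun w hw => by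
    rw [← hsame w (hi.trans (hmin w hw))]
    exact hsib w hw
  by_cases e : u = v
  · subst e
    exact hclose b hub hsib'
  · have hne : pos u ≠ i := fun e' => e (hinj (e'.trans hv.symm))
    exact hext _ _ (h u hu (by omega) hmin b hub hsib')

lemma IsFilledBelow.step_of_some {i : ℕ} (h : IsFilledBelow G root pos p c₁ i c)
    (hinj : Function.Injective pos) {v : V} (hv : pos v = i) (hcv : c v ≠ none) :
    IsFilledBelow G root pos p c₁ (i + 1) c := by
  have hlt : ∀ w, pos w < i + 1 → w = v ∨ pos w < i := fun w hw => by
    by_cases e : pos w = i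
    · exact .inl (hinj (e.trans hv.symm))
    · exact .inr (by omega)
  refine ⟨h.extends_start, fun w hw => h.pending w (by omega), fun w hw => ?_, h.root_black,
    fun w hw hi hcw => ?_⟩
  · rcases hlt w hw with rfl | hw
    · exact hcv
    · exact h.done w hw
  · rcases hlt w hi with rfl | hi
    · exact absurd ((h.pending w hv.ge).trans hcw) hcv
    · exact h.rule w hw hi hcw

lemma IsFilledBelow.step_of_none [DecidableEq V] {i : ℕ} (h : IsFilledBelow G root pos p c₁ i c)
    (ht : IsSearchTree G root pos p) {v : V} (hv : pos v = i) (hr : v ≠ root) (hcv : c v = none)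
    {x : Bool} (hx : x = false ↔
      c (p v) ≠ some false ∧ ∀ w, IsSibling G root p v w → c w ≠ some false) :
    IsFilledBelow G root pos p c₁ (i + 1) (Function.update c v (some x)) := by
  have hlt : ∀ w, pos w < i + 1 → w = v ∨ pos w < i := fun w hw => by
    by_cases e : pos w = i
    · exact .inl (ht.inj (e.trans hv.symm))
    · exact .inr (by omega)
  have hupd : ∀ w, w ≠ v → Function.update c v (some x) w = c w :=
    fun w hw => Function.update_of_ne hw _ _
  have hcv₁ : c₁ v = none := (h.pending v hv.ge).symm.trans hcv
  have hsibv : ∀ w, IsSibling G root p v w → w ≠ v := fun w hw => hw.2.2.ne'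
  have hpv : ∀ w, w ≠ root → pos w ≤ i → p w ≠ v := fun w hw hwi e => by
    have := ht.lt w hw
    rw [e] at this
    omega
  refine ⟨fun w b hw => ?_, fun w hw => ?_, fun w hw => ?_, fun hroot => ?_,
    fun w hw hi hcw => ?_⟩
  · rw [hupd w (by rintro rfl; simp [hcv₁] at hw)]
    exact h.extends_start w b hw
  · rw [hupd w (by rintro rfl; omega)]
    exact h.pending w (by omega)
  · rcases hlt w hw with rfl | hw
    · simp
    · rw [hupd w (by rintro rfl; omega)]
      exact h.done w hw
  · rw [hupd _ hr.symm]
    exact h.root_black hroot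
  · rcases hlt w hi with rfl | hi
    · rw [Function.update_self, hupd _ (hpv w hw hv.le), Option.some.injEq, hx]
      refine and_congr_right fun _ => forall_congr' fun u => imp_congr_right fun hu => ?_
      rw [hupd u (hsibv u hu)]
    · have hwv : w ≠ v := by rintro rfl; omega
      rw [hupd w hwv, hupd _ (hpv w hw hi.le), h.rule w hw hi hcw]
      refine ⟨fun ⟨h1, h2⟩ => ⟨h1, fun u hu => ?_⟩, fun ⟨h1, h2⟩ => ⟨h1, fun u hu => ?_⟩⟩
      · by_cases e : u = v
        · -- The sibling `w` of `v` is white, so `v` becomes black.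
          subst e
          have hcw' : c w = some false := (h.rule w hw hi hcw).2 ⟨h1, h2⟩
          simp only [Function.update_self, ne_eq, Option.some.injEq]
          exact fun hxf => (hx.1 hxf).2 w (hu.symm hw) hcw'
        · rw [hupd u e]
          exact h2 u hu
      · by_cases e : u = v
        · simp [e, hcv]
        · have := h2 u hu
          rwa [hupd u e] at this

namespace IsSearchTree

variable (ht : IsSearchTree G root pos p)
include ht

/-- If a vertex and its siblings are colored alike, coloring their uncolored parent is a step of
the color propagation. -/
lemma forceStep [Finite V] [DecidableEq V] (hG : IsBlockGraph G) {v : V} (hv : v ≠ root) {b : Bool}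
    (hvb : c v = some b) (hs : ∀ w, IsSibling G root p v w → c w = some b) (hp : c (p v) = none) :
    ForceStep G c (Function.update c (p v) (some (!b))) := by
  refine ⟨_, ht.isMaximalClique_upClique hG hv, p v, .inl rfl, hp, b, ?_, ?_⟩
  · rintro u (rfl | rfl | hu) hne
    · exact absurd rfl hne
    · exact hvb
    · exact hs u hu
  · congr
    exact Subsingleton.elim _ _

lemma not_exists_isSpanningEvenTree [Finite V] (hG : IsBlockGraph G) (hc : IsForcedInvariant G c)
    {v : V} (hv : v ≠ root) {b : Bool} (hvb : c v = some b)
    (hs : ∀ w, IsSibling G root p v w → c w = some b) (hp : c (p v) = some b) :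
    ¬ ∃ T, IsSpanningEvenTree G T := by
  rintro ⟨T, hT⟩
  obtain ⟨d, hd⟩ := hT.2.exists_isAdmissible
  have hagree := hc.agrees T d hT hd
  obtain ⟨w, hw, hne⟩ := (ht.isMaximalClique_upClique hG hv).exists_ne_of_isAdmissible hG hT hd
    (.inl rfl) (.inr (.inl rfl)) (ht.adj v hv).ne
  rw [hagree _ _ hp] at hne
  rcases hw with rfl | rfl | hw
  · exact hne (hagree _ _ hp)
  · exact hne (hagree _ _ hvb)
  · exact hne (hagree _ _ (hs w hw))

/-- The coloring that results from the two passes is good. -/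
lemma isGoodColoring [Finite V] (hG : IsBlockGraph G) (hinv : IsForcedInvariant G c₁)
    (hforced : IsForcedFrom G root pos p 1 c₁) {i : ℕ} (hi : ∀ v, pos v < i)
    (hfill : IsFilledBelow G root pos p c₁ i c) {d : V → Bool} (hd : ∀ v, c v = some (d v)) :
    IsGoodColoring G d := by
  have hd₁ : ∀ {v b}, c₁ v = some b → d v = b := fun {v b} hv => by
    have := hfill.extends_start v b hv
    rw [hd] at this
    exact Option.some.inj this
  refine ⟨fun v hv => hd₁ (hinv.leaf v hv), fun B hB x hx y hy hxy => ?_, fun v hv => ?_⟩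
  · by_contra! hmono
    obtain ⟨v, hv, rfl, hmin⟩ := ht.exists_eq_upClique hG hB hx hy hxy
    -- In a monochromatic clique the top-down rule cannot have been applied to a child: it would
    -- have produced a white vertex exactly if all other vertices are black.
    have hcol : ∀ w, w ≠ root → p w = p v → w ∈ UpClique G root p v →
        (∀ u, IsSibling G root p w u → u ∈ UpClique G root p v) → c₁ w = some (d x) := by
      intro w hw hpw hmem hsub
      have hrule := hfill.rule w hw (hi w)
      have hpm : d (p w) = d x := hmono _ (.inl hpw)
      cases e : c₁ w with
      | some b => rw [← hmono w hmem, hd₁ e]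
      | none =>
        have hrule := hrule e
        simp only [hd, Option.some.injEq, ne_eq, hmono w hmem, hpm] at hrule
        cases hb : d x
        · simp [hb] at hrule
        · simp only [hb, Bool.true_eq_false, not_false_eq_true, true_and, false_iff] at hrule
          exact absurd (fun u hu => by simp [hmono u (hsub u hu), hb]) hrule
    have hv' : c₁ v = some (d x) :=
      hcol v hv rfl (.inr (.inl rfl)) fun u hu => .inr (.inr hu)
    have hs' : ∀ w, IsSibling G root p v w → c₁ w = some (d x) := fun w hw =>
      hcol w hw.1 hw.2.1 (.inr (.inr hw)) fun u hu => by
        by_cases e : u = v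
        · exact .inr (.inl e)
        · exact .inr (.inr (ht.isSibling_trans hG hw.1 (hw.symm hv) hu (Ne.symm e)))
    have hpos : 1 ≤ pos v := by
      have := ht.root_lt hv
      omega
    -- So all children were colored by the bottom-up pass, and it has colored the parent too.
    have h1 := hd₁ (hforced v hv hpos hmin _ hv' hs')
    rw [hmono _ (.inl rfl)] at h1
    simp at h1
  · cases e : c₁ v with
    | some b =>
      have hb := hd₁ e
      rw [hv] at hb
      subst hb
      obtain ⟨B, hB, hvB, hblack⟩ := hinv.white v e
      exact ⟨B, hB, hvB, fun u hu hne => hd₁ (hblack u hu hne)⟩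
    | none =>
      have hr : v ≠ root := by
        rintro rfl
        exact hfill.root_black e (by rw [hd, hv])
      have hrule := (hfill.rule v hr (hi v) e).1 (by rw [hd, hv])
      refine ⟨_, ht.isMaximalClique_upClique hG hr, .inr (.inl rfl), ?_⟩
      rintro u (rfl | rfl | hu) hne
      · have := hrule.1
        rw [hd] at this
        simpa using this
      · exact absurd rfl hne
      · have := hrule.2 u hu
        rw [hd] at this
        simpa using this

end IsSearchTree

/-! ### The spanning tree that is output -/

/-- The graph that joins each vertex `v` but the root to `q v`. -/
def linkGraph (root : V) (q : V → V) : SimpleGraph V := fromRel fun u v => u ≠ root ∧ q u = v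

/-- `q` chooses for each vertex but the root a neighbor of the other color: the parent, or, if the
parent has the wrong color, a sibling. -/
def IsLink (G : SimpleGraph V) (root : V) (p : V → V) (d : V → Bool) (q : V → V) : Prop :=
  ∀ v, v ≠ root → (d (p v) ≠ d v ∧ q v = p v) ∨
    (d (p v) = d v ∧ IsSibling G root p v (q v) ∧ d (q v) ≠ d v)

lemma IsLink.ne {d : V → Bool} {q : V → V} (hq : IsLink G root p d q) {v : V} (hv : v ≠ root) :
    d (q v) ≠ d v := by
  rcases hq v hv with ⟨h1, h2⟩ | ⟨_, _, h2⟩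
  · rwa [h2]
  · exact h2

lemma IsLink.adj {d : V → Bool} {q : V → V} (hq : IsLink G root p d q)
    (ht : IsSearchTree G root pos p) {v : V} (hv : v ≠ root) : G.Adj v (q v) := by
  rcases hq v hv with ⟨_, h2⟩ | ⟨_, h2, _⟩
  · rw [h2]; exact (ht.adj v hv).symm
  · exact h2.2.2

lemma IsLink.linkGraph_adj {d : V → Bool} {q : V → V} (hq : IsLink G root p d q) {v : V}
    (hv : v ≠ root) : (linkGraph root q).Adj v (q v) := by
  rw [linkGraph, fromRel_adj]
  exact ⟨fun e => hq.ne hv (congrArg d e.symm), .inl ⟨hv, rfl⟩⟩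

/-- The links form a tree: a link to a sibling is followed by one to the common parent, so they
all lead to the root, and there are fewer links than vertices. -/
lemma IsLink.isTree [Finite V] {d : V → Bool} {q : V → V} (hq : IsLink G root p d q)
    (ht : IsSearchTree G root pos p) : (linkGraph root q).IsTree := by
  have hparent : ∀ v, v ≠ root → (linkGraph root q).Reachable v (p v) := by
    intro v hv
    rcases hq v hv with ⟨_, h2⟩ | ⟨h1, h2, h3⟩
    · exact h2 ▸ (hq.linkGraph_adj hv).reachable
    · have hs := hq.linkGraph_adj h2.1
      rcases hq (q v) h2.1 with ⟨_, h5⟩ | ⟨h4, _⟩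
      · rw [h5, h2.2.1] at hs
        exact (hq.linkGraph_adj hv).reachable.trans hs.reachable
      · rw [h2.2.1, h1] at h4
        exact absurd h4.symm h3
  have hroot : ∀ k v, pos v = k → (linkGraph root q).Reachable v root := by
    intro k
    induction k using Nat.strong_induction_on with
    | _ k ih =>
      intro v hv
      by_cases hr : v = root
      · rw [hr]
      · exact (hparent v hr).trans (ih _ (hv ▸ ht.lt v hr) _ rfl)
  have hcon : (linkGraph root q).Connected :=
    (connected_iff _).2 ⟨fun u v => (hroot _ u rfl).trans (hroot _ v rfl).symm, ⟨root⟩⟩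
  refine isTree_iff_connected_and_card.2 ⟨hcon, le_antisymm ?_ ?_⟩
  · have hsub : (linkGraph root q).edgeSet ⊆ (fun v => s(v, q v)) '' ({root}ᶜ : Set V) := by
      intro e
      induction e with
      | _ a b =>
        rw [mem_edgeSet, linkGraph, fromRel_adj]
        rintro ⟨-, ⟨h1, rfl⟩ | ⟨h1, rfl⟩⟩
        · exact ⟨a, h1, rfl⟩
        · exact ⟨b, h1, Sym2.eq_swap⟩
    have h1 := Set.ncard_le_ncard hsub (Set.toFinite _)
    have h2 := Set.ncard_image_le (f := fun v => s(v, q v)) (Set.toFinite ({root}ᶜ : Set V))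
    have h3 := Set.ncard_add_ncard_compl ({root} : Set V)
    rw [Set.ncard_singleton] at h3
    rw [← Nat.card_coe_set_eq] at h1
    omega
  · exact hcon.card_vert_le_card_edgeSet_add_one

lemma IsLink.isSpanningEvenTree [Finite V] {d : V → Bool} {q : V → V}
    (hq : IsLink G root p d q) (ht : IsSearchTree G root pos p) (hG : IsBlockGraph G)
    (hd : IsGoodColoring G d) : IsSpanningEvenTree G (linkGraph root q) := by
  refine hd.isSpanningEvenTree hG ?_ (hq.isTree ht) ?_
  · intro u v huv
    rw [linkGraph, fromRel_adj] at huv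
    rcases huv.2 with ⟨h1, rfl⟩ | ⟨h1, rfl⟩
    · exact hq.adj ht h1
    · exact (hq.adj ht h1).symm
  · intro u v huv
    rw [linkGraph, fromRel_adj] at huv
    rcases huv.2 with ⟨h1, rfl⟩ | ⟨h1, rfl⟩
    · exact (hq.ne h1).symm
    · exact hq.ne h1

/-- With a good coloring, a vertex that has the color of its parent has a sibling of the other
color. -/
lemma IsSearchTree.exists_sibling_ne [Finite V] (ht : IsSearchTree G root pos p)
    (hG : IsBlockGraph G) {d : V → Bool} (hd : IsGoodColoring G d) {v : V} (hv : v ≠ root)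
    (hpv : d (p v) = d v) : ∃ w, IsSibling G root p v w ∧ d w = !d v := by
  obtain ⟨w, hw, hne⟩ := hd.bichromatic _ (ht.isMaximalClique_upClique hG hv) v (.inr (.inl rfl))
    (p v) (.inl rfl) (ht.adj v hv).ne'
  rcases hw with rfl | rfl | hw
  · exact absurd hpv hne
  · exact absurd rfl hne
  · exact ⟨w, hw, Bool.eq_not_of_ne hne⟩

end SearchTreeColoring

section ProgramLogic

/-! ### Reasoning about programs -/

/-- The program `P`, started in state `s` when the clock shows `k`, halts, and the final state and
clock satisfy `Q`. -/
def Runs (P : Program) (s : RAMState) (k : ℕ) (Q : RAMState → ℕ → Prop) : Prop :=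
  ∃ t s', Exec P s t s' ∧ Q s' (k + t)

variable {s : RAMState} {k : ℕ} {Q Q' : RAMState → ℕ → Prop} {P R : Program} {b : Cond}

@[simp] lemma setReg_reg (x y m : ℕ) : (s.setReg x m).reg y = if y = x then m else s.reg y := by
  simp [RAMState.setReg, Function.update_apply]

@[simp] lemma setReg_arr (x m : ℕ) : (s.setReg x m).arr = s.arr := rfl

@[simp] lemma setArr_reg (a i m : ℕ) : (s.setArr a i m).reg = s.reg := rfl

@[simp] lemma setArr_arr (a i m a' i' : ℕ) :
    (s.setArr a i m).arr a' i' = if a' = a ∧ i' = i then m else s.arr a' i' := by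
  by_cases h : a' = a
  · subst h
    simp [RAMState.setArr, Function.update_apply]
  · simp [RAMState.setArr, h]

@[simp] lemma holds_eq (x y : ℕ) : (Cond.eq x y).Holds s ↔ s.reg x = s.reg y := Iff.rfl

@[simp] lemma holds_lt (x y : ℕ) : (Cond.lt x y).Holds s ↔ s.reg x < s.reg y := Iff.rfl

@[simp] lemma runs_skip : Runs .skip s k Q ↔ Q s (k + 1) :=
  ⟨fun ⟨_, _, h, hq⟩ => by cases h; exact hq, fun h => ⟨_, _, .skip s, h⟩⟩

@[simp] lemma runs_const (x m : ℕ) : Runs (.const x m) s k Q ↔ Q (s.setReg x m) (k + 1) :=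
  ⟨fun ⟨_, _, h, hq⟩ => by cases h; exact hq, fun h => ⟨_, _, .const s x m, h⟩⟩

@[simp] lemma runs_copy (x y : ℕ) : Runs (.copy x y) s k Q ↔ Q (s.setReg x (s.reg y)) (k + 1) :=
  ⟨fun ⟨_, _, h, hq⟩ => by cases h; exact hq, fun h => ⟨_, _, .copy s x y, h⟩⟩

@[simp] lemma runs_inc (x : ℕ) : Runs (.inc x) s k Q ↔ Q (s.setReg x (s.reg x + 1)) (k + 1) :=
  ⟨fun ⟨_, _, h, hq⟩ => by cases h; exact hq, fun h => ⟨_, _, .inc s x, h⟩⟩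

@[simp] lemma runs_dec (x : ℕ) : Runs (.dec x) s k Q ↔ Q (s.setReg x (s.reg x - 1)) (k + 1) :=
  ⟨fun ⟨_, _, h, hq⟩ => by cases h; exact hq, fun h => ⟨_, _, .dec s x, h⟩⟩

@[simp] lemma runs_load (x a i : ℕ) :
    Runs (.load x a i) s k Q ↔ Q (s.setReg x (s.arr a (s.reg i))) (k + 1) :=
  ⟨fun ⟨_, _, h, hq⟩ => by cases h; exact hq, fun h => ⟨_, _, .load s x a i, h⟩⟩

@[simp] lemma runs_store (a i x : ℕ) :
    Runs (.store a i x) s k Q ↔ Q (s.setArr a (s.reg i) (s.reg x)) (k + 1) :=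
  ⟨fun ⟨_, _, h, hq⟩ => by cases h; exact hq, fun h => ⟨_, _, .store s a i x, h⟩⟩

@[simp] lemma runs_seq :
    Runs (.seq P R) s k Q ↔ Runs P s k fun s' k' => Runs R s' k' Q := by
  constructor
  · rintro ⟨_, s', h, hq⟩
    cases h with
    | seq h1 h2 => exact ⟨_, _, h1, _, _, h2, by rwa [Nat.add_assoc]⟩
  · rintro ⟨t, s₁, h1, u, s₂, h2, hq⟩
    exact ⟨_, _, .seq h1 h2, by rwa [← Nat.add_assoc]⟩

@[simp] lemma runs_ite :
    Runs (.ite b P R) s k Q ↔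
      (b.Holds s → Runs P s (k + 1) Q) ∧ (¬ b.Holds s → Runs R s (k + 1) Q) := by
  constructor
  · rintro ⟨_, s', h, hq⟩
    cases h with
    | iteTrue hb h => exact ⟨fun _ => ⟨_, _, h, by rwa [Nat.add_assoc]⟩, fun hn => absurd hb hn⟩
    | iteFalse hb h => exact ⟨fun hn => absurd hn hb, fun _ => ⟨_, _, h, by rwa [Nat.add_assoc]⟩⟩
  · rintro ⟨h1, h2⟩
    by_cases hb : b.Holds s
    · obtain ⟨t, s', h, hq⟩ := h1 hb
      exact ⟨_, _, .iteTrue hb h, by rwa [← Nat.add_assoc]⟩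
    · obtain ⟨t, s', h, hq⟩ := h2 hb
      exact ⟨_, _, .iteFalse hb h, by rwa [← Nat.add_assoc]⟩

lemma Runs.mono (h : Runs P s k Q) (hQ : ∀ s' k', Q s' k' → Q' s' k') : Runs P s k Q' :=
  let ⟨t, s', h1, h2⟩ := h
  ⟨t, s', h1, hQ _ _ h2⟩

/-- A loop with invariant `I` and variant `μ`. -/
lemma Runs.loop (I : RAMState → ℕ → Prop) (μ : RAMState → ℕ) (h0 : I s k)
    (hstep : ∀ s k, I s k → b.Holds s → Runs P s (k + 1) fun s' k' => I s' k' ∧ μ s' < μ s)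
    (hdone : ∀ s k, I s k → ¬ b.Holds s → Q s (k + 1)) : Runs (.loop b P) s k Q := by
  have key : ∀ m s k, μ s = m → I s k → Runs (.loop b P) s k Q := by
    intro m
    induction m using Nat.strong_induction_on with
    | _ m ih =>
      intro s k hm hI
      by_cases hb : b.Holds s
      · obtain ⟨t, s', h, hI', hlt⟩ := hstep s k hI hb
        obtain ⟨u, s'', h', hq⟩ := ih _ (hm ▸ hlt) s' _ rfl hI'
        exact ⟨_, _, .loopStep hb h h', by rwa [← Nat.add_assoc, ← Nat.add_assoc]⟩
      · exact ⟨1, s, .loopDone hb, hdone s k hI hb⟩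
  exact key _ s k rfl h0

/-- Run `body` with register `i` counting up, as long as it is less than register `e`. -/
def forUp (i e : ℕ) (body : Program) : Program := .loop (.lt i e) (.seq body (.inc i))

/-- Run `body` with register `i` counting down, as long as it is greater than register `e`; the
register is decremented before `body` runs. -/
def forDown (i e : ℕ) (body : Program) : Program := .loop (.lt e i) (.seq (.dec i) body)

open Finset in
/-- A counting loop. `I j` holds before the round in which the counter is `j`, and must not depend
on the counter; this round takes at most `f j` steps, besides the test and the increment. -/
lemma Runs.forUp {i e : ℕ} {body : Program} (I : ℕ → RAMState → Prop) (f : ℕ → ℕ) {x y : ℕ}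
    (hxy : x ≤ y) (hi : s.reg i = x) (he : s.reg e = y) (hie : i ≠ e)
    (hI : I x s) (hins : ∀ j s m, I j s → I j (s.setReg i m))
    (hstep : ∀ j s k, x ≤ j → j < y → s.reg i = j → s.reg e = y → I j s →
      Runs body s k fun s' k' =>
        s'.reg i = j ∧ s'.reg e = y ∧ I (j + 1) s' ∧ k' ≤ k + f j)
    (hQ : ∀ s' k', I y s' → k' ≤ k + ∑ j ∈ Ico x y, (f j + 2) + 1 → Q s' k') :
    Runs (forUp i e body) s k Q := by
  refine Runs.loop (fun s' k' => ∃ j, x ≤ j ∧ j ≤ y ∧ s'.reg i = j ∧ s'.reg e = y ∧ I j s' ∧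
    k' ≤ k + ∑ j ∈ Ico x j, (f j + 2)) (fun s => y - s.reg i)
    ⟨x, le_rfl, hxy, hi, he, hI, by simp⟩ ?_ ?_
  · rintro s k' ⟨j, hxj, hjy, hj, hy, hIj, hk⟩ hlt
    rw [holds_lt, hj, hy] at hlt
    rw [runs_seq]
    refine (hstep j s (k' + 1) hxj hlt hj hy hIj).mono ?_
    rintro s' k'' ⟨hj', hy', hI', hk'⟩
    rw [runs_inc]
    refine ⟨⟨j + 1, by omega, hlt, by simp [hj'], by simp [hie.symm, hy'], hins _ _ _ hI', ?_⟩, ?_⟩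
    · rw [sum_Ico_succ_top hxj]
      omega
    · simp only [setReg_reg, if_true, hj', hj]
      omega
  · rintro s k' ⟨j, hxj, hjy, hj, hy, hIj, hk⟩ hlt
    rw [holds_lt, hj, hy] at hlt
    obtain rfl : j = y := by omega
    exact hQ _ _ hIj (by omega)

open Finset in
/-- The counterpart of `Runs.forUp` for loops that count down; `I (j + 1)` holds before the round
in which the counter is `j`. -/
lemma Runs.forDown {i e : ℕ} {body : Program} (I : ℕ → RAMState → Prop) (f : ℕ → ℕ) {x y : ℕ}
    (hxy : x ≤ y) (hi : s.reg i = y) (he : s.reg e = x) (hie : i ≠ e)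
    (hI : I y s) (hins : ∀ j s m, I j s → I j (s.setReg i m))
    (hstep : ∀ j s k, x ≤ j → j < y → s.reg i = j → s.reg e = x → I (j + 1) s →
      Runs body s k fun s' k' => s'.reg i = j ∧ s'.reg e = x ∧ I j s' ∧ k' ≤ k + f j)
    (hQ : ∀ s' k', I x s' → k' ≤ k + ∑ j ∈ Ico x y, (f j + 2) + 1 → Q s' k') :
    Runs (forDown i e body) s k Q := by
  refine Runs.loop (fun s' k' => ∃ j, x ≤ j ∧ j ≤ y ∧ s'.reg i = j ∧ s'.reg e = x ∧ I j s' ∧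
    k' + ∑ j ∈ Ico x j, (f j + 2) ≤ k + ∑ j ∈ Ico x y, (f j + 2)) (fun s => s.reg i)
    ⟨y, hxy, le_rfl, hi, he, hI, le_rfl⟩ ?_ ?_
  · rintro s k' ⟨j, hxj, hjy, hj, hx, hIj, hk⟩ hlt
    rw [holds_lt, hj, hx] at hlt
    obtain ⟨j, rfl⟩ : ∃ j', j = j' + 1 := ⟨j - 1, by omega⟩
    rw [runs_seq, runs_dec, hj, Nat.add_sub_cancel]
    refine (hstep j _ (k' + 1 + 1) (by omega) (by omega) (by simp) (by simp [hie.symm, hx])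
      (hins _ _ _ hIj)).mono ?_
    rintro s' k'' ⟨hj', hx', hI', hk'⟩
    rw [sum_Ico_succ_top (by omega)] at hk
    exact ⟨⟨j, by omega, by omega, hj', hx', hI', by omega⟩, by omega⟩
  · rintro s k' ⟨j, hxj, hjy, hj, hx, hIj, hk⟩ hlt
    rw [holds_lt, hj, hx] at hlt
    obtain rfl : j = x := by omega
    exact hQ _ _ hIj (by simp at hk; omega)

open Finset in
/-- If round `j` of a loop deals with the vertices at position `j`, then all rounds together cost at
most the sum over all vertices. -/
lemma sum_Ico_charge_le {ι : Type*} [Fintype ι] (pos : ι → ℕ) (cost : ι → ℕ) (x y : ℕ) :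
    ∑ j ∈ Ico x y, ∑ v with pos v = j, cost v ≤ ∑ v, cost v := by
  rw [sum_comm' (t' := univ.filter fun v => pos v ∈ Ico x y) (s' := fun v => {pos v})]
  · simp only [sum_singleton]
    exact sum_le_sum_of_subset (filter_subset _ _)
  · intro j v
    simp only [mem_filter, mem_univ, true_and, mem_singleton]
    constructor
    · rintro ⟨h1, rfl⟩; exact ⟨rfl, h1⟩
    · rintro ⟨rfl, h1⟩; exact ⟨h1, rfl⟩

end ProgramLogic

section Scan

variable {n : ℕ} {adj : Fin n → List (Fin n)} {s s' : RAMState} {k : ℕ}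

/-! ### Scanning an adjacency list -/

/-- The state contains the input: `n` in register 0 and the adjacency lists in the arrays 0 and 1.
Register 14 is zero, for comparisons, and so is register 1: no answer has been given. -/
structure HasInput (adj : Fin n → List (Fin n)) (s : RAMState) : Prop where
  size : s.reg 0 = n
  answer : s.reg 1 = 0
  zero : s.reg 14 = 0
  next : ∀ v : Fin n, s.arr 0 (v + 1) = s.arr 0 v + (adj v).length
  nbr : ∀ (v : Fin n) (j : ℕ) (hj : j < (adj v).length), s.arr 1 (s.arr 0 v + j) = (adj v)[j]

lemma HasInput.congr (h : HasInput adj s) (hr : ∀ r, r < 2 ∨ r = 14 → s'.reg r = s.reg r)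
    (ha : ∀ a i, a < 2 → s'.arr a i = s.arr a i) : HasInput adj s' :=
  ⟨(hr 0 (by omega)).trans h.size, (hr 1 (by omega)).trans h.answer,
    (hr 14 (by omega)).trans h.zero, fun v => by rw [ha _ _ (by omega), ha _ _ (by omega), h.next],
    fun v j hj => by rw [ha _ _ (by omega), ha _ _ (by omega), h.nbr v j hj]⟩

lemma hasInput_inputState (adj : Fin n → List (Fin n)) : HasInput adj (inputState adj) where
  size := by simp [inputState]
  answer := by simp [inputState]
  zero := by simp [inputState]
  next v := by
    have h1 : (v : ℕ) + 1 ≤ n := v.2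
    have h2 : (v : ℕ) ≤ n := v.2.le
    simp only [inputState, if_true, h1, h2]
    rw [List.take_add_one, List.flatten_append, List.length_append]
    simp
  nbr v j hj := by
    have h2 : (v : ℕ) ≤ n := v.2.le
    have hlen : (v : ℕ) < (List.ofFn adj).length := by simp
    simp only [inputState, if_true, h2, one_ne_zero, if_false]
    have hsplit : List.ofFn adj =
        (List.ofFn adj).take v ++ adj v :: (List.ofFn adj).drop (v + 1) := by
      conv_lhs => rw [← List.take_append_drop v (List.ofFn adj), List.drop_eq_getElem_cons hlen]
      simp
    have hfl : (List.ofFn adj).flatten = ((List.ofFn adj).take v).flatten ++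
        (adj v ++ ((List.ofFn adj).drop (v + 1)).flatten) := by
      conv_lhs => rw [hsplit]
      simp
    rw [hfl, List.map_append, List.getD_append_right _ _ _ _ (by rw [List.length_map]; omega)]
    rw [List.length_map, Nat.add_sub_cancel_left, List.map_append,
      List.getD_append _ _ _ _ (by simpa using hj)]
    simp [List.getD_eq_getElem?_getD, hj]

/-- Load the bounds of the adjacency list of the vertex in register 4 into the registers 20 and
21. Register 23 is scratch. -/
def loadBounds : Program :=
  .seq (.load 20 0 4) (.seq (.copy 23 4) (.seq (.inc 23) (.load 21 0 23)))

/-- Search the siblings of the vertex in register 4 for one with the color code in register 10.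
Register 25 is set to the sibling plus one, or to zero if there is none. -/
def scanSiblings : Program :=
  .seq (.const 25 0) <| .seq (.load 24 5 4) <| .seq loadBounds <|
  forUp 20 21 <| .seq (.load 22 1 20) <| .seq (.load 23 5 22) <|
    .ite (.eq 23 24)
      (.seq (.load 23 4 22) (.ite (.eq 23 10) (.seq (.copy 25 22) (.inc 25)) .skip))
      .skip

/-- The outcome of a search for a neighbor of `v` with the same entry in the parent array and color
code `m`. -/
def ScanResult (adj : Fin n → List (Fin n)) (arr : ℕ → ℕ → ℕ) (v : Fin n) (m r : ℕ) : Prop :=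
  (r = 0 ∧ ∀ w ∈ adj v, arr 5 w = arr 5 v → arr 4 w ≠ m) ∨
    ∃ w ∈ adj v, arr 5 w = arr 5 v ∧ arr 4 w = m ∧ r = w + 1

lemma runs_scanSiblings {v : Fin n} {Q : RAMState → ℕ → Prop} (h : HasInput adj s)
    (hv : s.reg 4 = v)
    (hQ : ∀ s' k', s'.arr = s.arr → (∀ r < 20, s'.reg r = s.reg r) →
      ScanResult adj s.arr v (s.reg 10) (s'.reg 25) → k' ≤ k + 12 * (adj v).length + 10 →
      Q s' k') :
    Runs scanSiblings s k Q := by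
  simp only [scanSiblings, loadBounds, runs_seq, runs_const, runs_load, runs_copy, runs_inc,
    setReg_reg, setReg_arr, hv, Nat.reduceEqDiff, if_true, if_false, h.next]
  refine Runs.forUp (fun j s' => s'.arr = s.arr ∧ (∀ r < 20, s'.reg r = s.reg r) ∧
      s'.reg 24 = s.arr 5 v ∧
      ((s'.reg 25 = 0 ∧ ∀ i, (hi : i < (adj v).length) → s.arr 0 v + i < j →
        s.arr 5 (adj v)[i] = s.arr 5 v → s.arr 4 (adj v)[i] ≠ s.reg 10) ∨
      ∃ w ∈ adj v, s.arr 5 w = s.arr 5 v ∧ s.arr 4 w = s.reg 10 ∧ s'.reg 25 = w + 1))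
    (fun _ => 8) (x := s.arr 0 v) (Nat.le_add_right _ (adj v).length) (by simp) (by simp)
    (by decide) ?_ ?_ ?_ ?_
  · refine ⟨rfl, fun r hr => ?_, by simp, .inl ⟨by simp, fun i hi hlt => by omega⟩⟩
    have : r ≠ 20 ∧ r ≠ 21 ∧ r ≠ 23 ∧ r ≠ 24 ∧ r ≠ 25 := by omega
    simp [this]
  · rintro j s' m ⟨h1, h2, h3, h4⟩
    refine ⟨h1, fun r hr => ?_, by simpa using h3, by simpa using h4⟩
    rw [setReg_reg, if_neg (by omega), h2 r hr]
  · rintro j s' k' hj hj' hr hr' ⟨h1, h2, h3, h4⟩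
    obtain ⟨i, rfl⟩ := Nat.exists_eq_add_of_le hj
    have hi : i < (adj v).length := by omega
    have hframe : ∀ r < 20, r ≠ 22 ∧ r ≠ 23 ∧ r ≠ 25 := by omega
    simp only [runs_seq, runs_load, runs_ite, runs_copy, runs_inc, runs_skip, setReg_reg,
      setReg_arr, holds_eq, Nat.reduceEqDiff, if_true, if_false, hr, hr', h1, h.nbr v i hi, h3,
      h2 10 (by omega)]
    refine ⟨fun hp => ⟨fun hc => ⟨trivial, trivial, ⟨trivial, fun r hr => ?_, trivial, ?_⟩, ?_⟩,
      fun hc => ⟨trivial, trivial, ⟨trivial, fun r hr => ?_, trivial, ?_⟩, ?_⟩⟩,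
      fun hp => ⟨trivial, trivial, ⟨trivial, fun r hr => ?_, trivial, ?_⟩, ?_⟩⟩
    · simp [hframe r hr, h2 r hr]
    · exact .inr ⟨_, List.getElem_mem hi, hp, hc, rfl⟩
    · omega
    · simp [hframe r hr, h2 r hr]
    · refine h4.imp (fun h4 => ⟨h4.1, fun i' hi' hlt hp' => ?_⟩) id
      rcases (by omega : i' = i ∨ i' < i) with rfl | hlt'
      · exact hc
      · exact h4.2 i' hi' (by omega) hp'
    · omega
    · simp [hframe r hr, h2 r hr]
    · refine h4.imp (fun h4 => ⟨h4.1, fun i' hi' hlt hp' => ?_⟩) id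
      rcases (by omega : i' = i ∨ i' < i) with rfl | hlt'
      · exact absurd hp' hp
      · exact h4.2 i' hi' (by omega) hp'
    · omega
  · rintro s' k' ⟨h1, h2, h3, h4⟩ hk
    refine hQ s' k' h1 h2 (h4.imp (fun h4 => ⟨h4.1, fun w hw => ?_⟩) id) ?_
    · obtain ⟨i, hi, rfl⟩ := List.getElem_of_mem hw
      exact h4.2 i hi (by omega)
    · simp only [Finset.sum_const, Nat.card_Ico, smul_eq_mul] at hk
      omega

end Scan

section PartialSearch

variable {V : Type*} {G : SimpleGraph V} {root : V} {ord : List V} {p : V → V} {h : ℕ}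

/-! ### The search program -/

/-- A breadth-first search that has found the vertices in the list `ord` so far, and has expanded
the first `h` of them: all neighbors of these have been found. -/
structure IsPartialSearch (G : SimpleGraph V) (root : V) (ord : List V) (p : V → V) (h : ℕ) :
    Prop where
  nodup : ord.Nodup
  root_first : ord[0]? = some root
  le_length : h ≤ ord.length
  parent : ∀ (i : ℕ) (v : V), ord[i]? = some v → v ≠ root →
    ∃ j < i, ord[j]? = some (p v) ∧ G.Adj (p v) v ∧
      ∀ i' < j, ∀ u : V, ord[i']? = some u → ¬ G.Adj u v
  closed : ∀ i < h, ∀ u : V, ord[i]? = some u → ∀ w, G.Adj u w → w ∈ ord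

lemma isPartialSearch_start (p : V → V) : IsPartialSearch G root [root] p 0 where
  nodup := by simp
  root_first := rfl
  le_length := by simp
  parent i v hv hr := by
    have := List.mem_of_getElem? hv
    exact absurd (by simpa using this) hr
  closed i hi := by omega

lemma IsPartialSearch.extend [DecidableEq V] (hs : IsPartialSearch G root ord p h) {v w : V}
    (hv : ord[h]? = some v) (hvw : G.Adj v w) (hw : w ∉ ord) :
    IsPartialSearch G root (ord ++ [w]) (Function.update p w v) h := by
  have hlt : h < ord.length := (List.getElem?_eq_some_iff.1 hv).1
  have hold : ∀ {i : ℕ} {u : V}, i < ord.length → (ord ++ [w])[i]? = some u → ord[i]? = some u :=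
    fun {i u} hi hu => by rwa [List.getElem?_append_left hi] at hu
  have hnew : ∀ {i : ℕ} {u : V}, ord[i]? = some u → (ord ++ [w])[i]? = some u :=
    fun {i u} hu => by rwa [List.getElem?_append_left (List.getElem?_eq_some_iff.1 hu).1]
  refine ⟨?_, hnew hs.root_first, by simp; omega, ?_, ?_⟩
  · rw [List.nodup_append]
    exact ⟨hs.nodup, by simp, fun a ha b hb e => hw (by simp at hb; rwa [← hb, ← e])⟩
  · intro i u hu hr
    by_cases hi : i < ord.length
    · have hu' := hold hi hu
      obtain ⟨j, hj, h1, h2, h3⟩ := hs.parent i u hu' hr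
      have huw : u ≠ w := fun e => hw (e ▸ List.mem_of_getElem? hu')
      rw [Function.update_of_ne huw]
      exact ⟨j, hj, hnew h1, h2, fun i' hi' x hx => h3 i' hi' x (hold (by omega) hx)⟩
    · have hlen := (List.getElem?_eq_some_iff.1 hu).1
      simp only [List.length_append, List.length_singleton] at hlen
      obtain rfl : i = ord.length := by omega
      simp only [List.length_append, List.length_singleton, lt_add_iff_pos_right, zero_lt_one,
        getElem?_pos, List.getElem_append_right, le_refl, List.getElem_singleton,
        Option.some.injEq] at hu
      subst hu
      rw [Function.update_self]
      exact ⟨h, hlt, hnew hv, hvw, fun i' hi' x hx hxw =>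
        hw (hs.closed i' hi' x (hold (by omega) hx) w hxw)⟩
  · intro i hi u hu x hx
    exact List.mem_append_left _ (hs.closed i hi u (hold (by omega) hu) x hx)

lemma IsPartialSearch.advance (hs : IsPartialSearch G root ord p h) {v : V}
    (hv : ord[h]? = some v) (hclosed : ∀ w, G.Adj v w → w ∈ ord) :
    IsPartialSearch G root ord p (h + 1) :=
  { hs with
    le_length := (List.getElem?_eq_some_iff.1 hv).1
    closed := fun i hi u hu w hw => by
      rcases (by omega : i = h ∨ i < h) with rfl | hi
      · rw [hv, Option.some.injEq] at hu
        exact hclosed w (hu ▸ hw)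
      · exact hs.closed i hi u hu w hw }

lemma IsPartialSearch.mem_of_connected (hs : IsPartialSearch G root ord p ord.length)
    (hc : G.Connected) (v : V) : v ∈ ord := by
  have key : ∀ {a b : V}, G.Walk a b → a ∈ ord → b ∈ ord := by
    intro a b q
    induction q with
    | nil => exact id
    | cons hab q ih =>
      intro ha
      obtain ⟨i, hi, rfl⟩ := List.getElem_of_mem ha
      exact ih (hs.closed i hi _ (List.getElem?_eq_getElem hi) _ hab)
  obtain ⟨q⟩ := hc.preconnected root v
  exact key q (List.mem_of_getElem? hs.root_first)

lemma IsPartialSearch.isSearchTree [DecidableEq V] (hs : IsPartialSearch G root ord p h)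
    (hall : ∀ v, v ∈ ord) : IsSearchTree G root (fun v => ord.idxOf v) p := by
  have hget : ∀ v, ord[ord.idxOf v]? = some v := fun v => List.getElem?_idxOf (hall v)
  have hidx : ∀ {i : ℕ} {v : V}, ord[i]? = some v → ord.idxOf v = i := fun {i v} hv => by
    obtain ⟨hi, rfl⟩ := List.getElem?_eq_some_iff.1 hv
    exact hs.nodup.idxOf_getElem i hi
  refine ⟨fun u v huv => ?_, fun v hv => ?_, fun v hv => ?_, fun v hv u hu => ?_⟩
  · have h1 := hget u
    have h2 := hget v
    rw [show ord.idxOf u = ord.idxOf v from huv, h2] at h1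
    exact (Option.some.inj h1).symm
  · obtain ⟨j, hj, h1, h2, h3⟩ := hs.parent _ v (hget v) hv
    exact h2
  · obtain ⟨j, hj, h1, h2, h3⟩ := hs.parent _ v (hget v) hv
    exact hidx h1 ▸ hj
  · obtain ⟨j, hj, h1, h2, h3⟩ := hs.parent _ v (hget v) hv
    simp only [hidx h1]
    by_contra hlt
    exact h3 _ (by omega) u (hget u) hu

end PartialSearch

section Search

variable {n : ℕ} {adj : Fin n → List (Fin n)} {G : SimpleGraph (Fin n)} {s s' : RAMState} {k : ℕ}

/-- The encoding of colors in the color array 4. -/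
def colorCode : Option Bool → ℕ
  | none => 0
  | some true => 1
  | some false => 2

/-- Array 4 holds the coloring `c`. -/
def HasColors (c : Fin n → Option Bool) (s : RAMState) : Prop :=
  ∀ v : Fin n, s.arr 4 v = colorCode (c v)

lemma isLeaf_iff_length (hadj : IsAdjacencyList G adj) (v : Fin n) :
    IsLeaf G v ↔ (adj v).length = 1 := by
  have : G.neighborSet v = ((adj v).toFinset : Set (Fin n)) := by
    ext u
    simp [(hadj v).2 u]
  rw [IsLeaf, this, Set.ncard_coe_finset, List.toFinset_card_of_nodup (hadj v).1]

/-- Color the vertices of degree one black. -/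
def colorLeaves : Program :=
  .seq (.const 2 0) <| forUp 2 0 <| .seq (.copy 4 2) <| .seq loadBounds <| .seq (.inc 20) <|
    .ite (.eq 20 21) (.seq (.const 16 1) (.store 4 2 16)) .skip

lemma runs_colorLeaves {Q : RAMState → ℕ → Prop} (h : HasInput adj s)
    (hadj : IsAdjacencyList G adj) (h4 : ∀ i, s.arr 4 i = 0)
    (hQ : ∀ s' k', HasInput adj s' → HasColors (initialColoring G) s' →
      (∀ i, s'.arr 5 i = s.arr 5 i) → k' ≤ k + 12 * n + 2 → Q s' k') :
    Runs colorLeaves s k Q := by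
  simp only [colorLeaves, runs_seq, runs_const]
  refine Runs.forUp (fun j s' => HasInput adj s' ∧ (∀ i, s'.arr 5 i = s.arr 5 i) ∧
    ∀ v : Fin n, s'.arr 4 v = if v < j then colorCode (initialColoring G v) else 0)
    (fun _ => 10) (x := 0) (Nat.zero_le n) (by simp) (by simp [h.size]) (by decide) ?_ ?_ ?_ ?_
  · exact ⟨h.congr (by rintro r hr; simp; omega) (by simp), by simp, by simp [h4]⟩
  · rintro j s' m ⟨h1, h2, h3⟩
    exact ⟨h1.congr (by rintro r hr; simp; omega) (by simp), h2, h3⟩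
  · rintro j s' k' - hj hr hr' ⟨h1, h2, h3⟩
    have hnext := h1.next ⟨j, hj⟩
    simp only at hnext
    have hleaf := isLeaf_iff_length hadj ⟨j, hj⟩
    have hfr : ∀ r, r < 2 ∨ r = 14 → r ≠ 4 ∧ r ≠ 20 ∧ r ≠ 21 ∧ r ≠ 23 ∧ r ≠ 16 := by omega
    simp only [loadBounds, runs_seq, runs_load, runs_ite, runs_copy, runs_inc, runs_skip,
      runs_const, runs_store, setReg_reg, setReg_arr, setArr_reg, setArr_arr, holds_eq,
      Nat.reduceEqDiff, if_true, if_false, hr, hr', hnext, false_and, true_and]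
    refine ⟨fun hd => ⟨⟨h1.congr ?_ ?_, h2, fun v => ?_⟩, by omega⟩,
      fun hd => ⟨⟨h1.congr ?_ ?_, h2, fun v => ?_⟩, by omega⟩⟩
    · intro r hr; simp [hfr r hr]
    · intro a i ha; simp; omega
    · by_cases hv : (v : ℕ) = j
      · have : v = ⟨j, hj⟩ := Fin.ext hv
        rw [if_pos hv, if_pos (by omega), initialColoring, this, if_pos (hleaf.2 (by omega))]
        rfl
      · rw [if_neg hv, h3 v]
        congr 1
        simp; omega
    · intro r hr; simp [hfr r hr]
    · intro a i ha; rfl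
    · by_cases hv : (v : ℕ) = j
      · have : v = ⟨j, hj⟩ := Fin.ext hv
        rw [h3 v, if_neg (by omega), if_pos (by omega), initialColoring, this,
          if_neg (fun hl => hd (by have := hleaf.1 hl; omega))]
        rfl
      · rw [h3 v]
        congr 1
        simp; omega
  · rintro s' k' ⟨h1, h2, h3⟩ hk
    refine hQ s' k' h1 (fun v => by rw [h3 v, if_pos v.2]) h2 ?_
    simp only [Finset.sum_const, Nat.card_Ico, smul_eq_mul] at hk
    omega

/-- Look at a neighbor of the vertex in register 4: if it has not been found before, record its
parent in array 5, and append it to the queue in array 6, whose length is in register 12. -/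
def visit : Program :=
  .seq (.load 22 1 20) <| .seq (.load 23 5 22) <| .ite (.eq 23 14)
    (.seq (.copy 24 4) <| .seq (.inc 24) <| .seq (.store 5 22 24) <|
      .seq (.store 6 12 22) (.inc 12))
    .skip

/-- Breadth-first search from the vertex `n - 1`. The entry of a vertex in array 5 is its parent
plus one, or `n + 1` for the root, or zero for a vertex that has not been found. -/
def search : Program :=
  .seq (.copy 4 0) <| .seq (.dec 4) <| .seq (.const 2 0) <| .seq (.store 6 2 4) <|
  .seq (.copy 16 0) <| .seq (.inc 16) <| .seq (.store 5 4 16) <| .seq (.const 12 1) <|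
  .loop (.lt 2 12) <|
    .seq (.load 4 6 2) <| .seq loadBounds <| .seq (forUp 20 21 visit) (.inc 2)

/-- The state represents a partial search that has found the vertices in `ord`: array 6 lists them,
and their parents, plus one, are in array 5, with the mark `n + 1` at the root and zero at the
vertices that have not been found. -/
structure HasSearch (adj : Fin n → List (Fin n)) (c : Fin n → Option Bool) (root : Fin n)
    (ord : List (Fin n)) (p : Fin n → Fin n) (s : RAMState) : Prop where
  input : HasInput adj s
  colors : HasColors c s
  par : ∀ v : Fin n, s.arr 5 v = if v ∈ ord then (if v = root then n + 1 else p v + 1) else 0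
  order : ∀ (i : ℕ) (v : Fin n), ord[i]? = some v → s.arr 6 i = v
  tail : s.reg 12 = ord.length

lemma HasSearch.congr {c : Fin n → Option Bool} {root : Fin n} {ord : List (Fin n)}
    {p : Fin n → Fin n} (h : HasSearch adj c root ord p s)
    (hr : ∀ r, r < 2 ∨ r = 14 ∨ r = 12 → s'.reg r = s.reg r) (ha : s'.arr = s.arr) :
    HasSearch adj c root ord p s' :=
  ⟨h.input.congr (fun r hr' => hr r (by omega)) (by simp [ha]),
    fun v => by rw [ha]; exact h.colors v, by rw [ha]; exact h.par, by rw [ha]; exact h.order,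
    (hr 12 (by omega)).trans h.tail⟩

lemma runs_visit {c : Fin n → Option Bool} {root v w : Fin n} {ord : List (Fin n)}
    {p : Fin n → Fin n} {h : ℕ} {Q : RAMState → ℕ → Prop} (hs : HasSearch adj c root ord p s)
    (hp : IsPartialSearch G root ord p h) (hv : s.reg 4 = v) (hord : ord[h]? = some v)
    (hw : s.arr 1 (s.reg 20) = w) (hvw : G.Adj v w)
    (hQ : ∀ s' k' ord' p', HasSearch adj c root ord' p' s' → IsPartialSearch G root ord' p' h →
      w ∈ ord' → ord <+: ord' → (∀ r < 22, r ≠ 12 → s'.reg r = s.reg r) →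
      (∀ i, s'.arr 0 i = s.arr 0 i) → k' ≤ k + 8 → Q s' k') :
    Runs visit s k Q := by
  have hframe : ∀ r < 22, r ≠ 22 ∧ r ≠ 23 ∧ r ≠ 24 := by omega
  have hfr : ∀ r, r < 2 ∨ r = 14 → r ≠ 22 ∧ r ≠ 23 ∧ r ≠ 24 ∧ r ≠ 12 := by omega
  simp only [visit, runs_seq, runs_load, runs_ite, runs_copy, runs_inc, runs_skip,
    runs_store, setReg_reg, setReg_arr, setArr_reg, holds_eq,
    Nat.reduceEqDiff, if_true, if_false, hw, hv, hs.input.zero, hs.par]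
  by_cases hmem : w ∈ ord
  · refine ⟨fun h0 => ?_, fun _ => ?_⟩
    · rw [if_pos hmem] at h0
      split_ifs at h0
    · refine hQ _ _ ord p (hs.congr ?_ rfl) hp hmem (List.prefix_refl _) ?_ (fun _ => rfl)
        (by omega)
      · intro r hr
        have : r ≠ 22 ∧ r ≠ 23 := by omega
        simp [this]
      · intro r hr _
        simp [hframe r hr]
  · refine ⟨fun _ => ?_, fun h0 => absurd (if_neg hmem) h0⟩
    have hwr : w ≠ root := fun e => hmem (e ▸ List.mem_of_getElem? hp.root_first)
    refine hQ _ _ (ord ++ [w]) (Function.update p w v) ⟨hs.input.congr ?_ ?_, ?_, ?_, ?_, ?_⟩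
      (hp.extend hord hvw hmem) (by simp) (List.prefix_append _ _) ?_ (fun i => by simp) (by omega)
    · intro r hr
      simp [hfr r hr]
    · intro a i ha
      have : a ≠ 5 ∧ a ≠ 6 := by omega
      simp [this]
    · intro u
      simp [hs.colors u]
    · intro u
      simp only [setReg_arr, setArr_arr]
      by_cases huw : u = w
      · subst huw
        simp [hwr]
      · have : (u : ℕ) ≠ w := fun e => huw (Fin.ext e)
        simp [this, huw, hs.par]
    · intro i u hu
      simp only [setReg_arr, setArr_arr]
      by_cases hi : i < ord.length
      · rw [List.getElem?_append_left hi] at hu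
        have : i ≠ s.reg 12 := by rw [hs.tail]; omega
        simp [this, hs.order i u hu]
      · have hlen := (List.getElem?_eq_some_iff.1 hu).1
        simp only [List.length_append, List.length_singleton] at hlen
        obtain rfl : i = ord.length := by omega
        simp only [List.getElem?_concat_length, Option.some.injEq] at hu
        simp [hs.tail, hu]
    · simp [hs.tail]
    · intro r hr hr'
      simp [hframe r hr, hr']

/-- The state holds a complete search tree: the parents, plus one, in array 5, with the mark `n + 1`
at the root, and the vertices in the order of their positions in array 6. -/
structure HasTree (G : SimpleGraph (Fin n)) (adj : Fin n → List (Fin n)) (root : Fin n)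
    (pos : Fin n → ℕ) (p : Fin n → Fin n) (s : RAMState) : Prop where
  input : HasInput adj s
  tree : IsSearchTree G root pos p
  pos_lt : ∀ v, pos v < n
  surj : ∀ j < n, ∃ v, pos v = j
  par : ∀ v : Fin n, s.arr 5 v = if v = root then n + 1 else p v + 1
  order : ∀ v : Fin n, s.arr 6 (pos v) = v

lemma IsPartialSearch.hasTree {c : Fin n → Option Bool} {root : Fin n} {ord : List (Fin n)}
    {p : Fin n → Fin n} {h : ℕ} (hp : IsPartialSearch G root ord p h)
    (hs : HasSearch adj c root ord p s) (hlen : ord.length = n) :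
    HasTree G adj root (fun v => ord.idxOf v) p s := by
  have hall : ∀ v, v ∈ ord := fun v => by
    have : ord.toFinset = Finset.univ := Finset.eq_univ_of_card _ (by
      rw [List.toFinset_card_of_nodup hp.nodup, hlen, Fintype.card_fin])
    have := this ▸ Finset.mem_univ v
    simpa using this
  refine ⟨hs.input, hp.isSearchTree hall, fun v => ?_, fun j hj => ⟨ord[j], ?_⟩, fun v => ?_,
    fun v => hs.order _ v (List.getElem?_idxOf (hall v))⟩
  · exact (List.idxOf_lt_length_of_mem (hall v)).trans_eq hlen
  · exact hp.nodup.idxOf_getElem j (by omega)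
  · rw [hs.par, if_pos (hall v)]

lemma sum_map_le_sum_univ {ι : Type*} [Fintype ι] [DecidableEq ι] {l : List ι} (hl : l.Nodup)
    (f : ι → ℕ) : (l.map f).sum ≤ ∑ v, f v := by
  rw [← List.sum_toFinset f hl]
  exact Finset.sum_le_sum_of_subset (Finset.subset_univ _)

lemma getElem?_of_prefix {ι : Type*} {l l' : List ι} (h : l <+: l') {i : ℕ} {v : ι}
    (hv : l[i]? = some v) : l'[i]? = some v := by
  obtain ⟨t, rfl⟩ := h
  rwa [List.getElem?_append_left (List.getElem?_eq_some_iff.1 hv).1]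

lemma runs_search {c : Fin n → Option Bool} {root : Fin n} {Q : RAMState → ℕ → Prop}
    (h : HasInput adj s) (hadj : IsAdjacencyList G adj) (hroot : (root : ℕ) = n - 1)
    (hc : HasColors c s) (h5 : ∀ i, s.arr 5 i = 0)
    (hfail : ∀ s' k', HasInput adj s' → s'.reg 12 ≠ n → ¬ G.Connected →
      k' ≤ k + ∑ v, (12 * (adj v).length + 10) + 9 → Q s' k')
    (hQ : ∀ s' k' pos p, HasTree G adj root pos p s' → HasColors c s' → s'.reg 12 = n →
      k' ≤ k + ∑ v, (12 * (adj v).length + 10) + 9 → Q s' k') :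
    Runs search s k Q := by
  have hn : 0 < n := root.pos
  simp only [search, runs_seq, runs_const, runs_store, runs_copy, runs_inc, runs_dec, setReg_reg,
    setArr_reg, Nat.reduceEqDiff, if_true, if_false, h.size, ← hroot]
  refine Runs.loop (fun s' k' => ∃ ord p h, HasSearch adj c root ord p s' ∧
    IsPartialSearch G root ord p h ∧ s'.reg 2 = h ∧
    k' ≤ k + 8 + ((ord.take h).map fun v => 12 * (adj v).length + 10).sum)
    (fun s => n - s.reg 2) ?_ ?_ ?_
  · refine ⟨[root], id, 0, ⟨h.congr ?_ ?_, fun v => by simp [hc v], fun v => ?_, ?_, by simp⟩,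
      isPartialSearch_start id, by simp, by simp⟩
    · intro r hr
      have : r ≠ 2 ∧ r ≠ 4 ∧ r ≠ 12 ∧ r ≠ 16 := by omega
      simp [this]
    · intro a i ha
      have : a ≠ 5 ∧ a ≠ 6 := by omega
      simp [this]
    · by_cases hv : v = root
      · simp [hv]
      · have : (v : ℕ) ≠ root := fun e => hv (Fin.ext e)
        simp [hv, this, h5]
    · intro i v hv
      have hi := (List.getElem?_eq_some_iff.1 hv).1
      simp only [List.length_singleton] at hi
      obtain rfl : i = 0 := by omega
      simp at hv
      simp [hv]
  · rintro s₁ k₁ ⟨ord, p, h, hs, hp, h2, hk⟩ hlt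
    rw [holds_lt, h2, hs.tail] at hlt
    obtain ⟨v, hv⟩ : ∃ v, ord[h]? = some v := ⟨_, List.getElem?_eq_getElem hlt⟩
    have hlen : ord.length ≤ n := by
      simpa using hp.nodup.length_le_card
    simp only [loadBounds, runs_seq, runs_load, runs_copy, runs_inc, setReg_reg, setReg_arr,
      Nat.reduceEqDiff, if_true, if_false, h2, hs.order h v hv, hs.input.next]
    refine Runs.forUp (fun j s' => ∃ ord' p', HasSearch adj c root ord' p' s' ∧
      IsPartialSearch G root ord' p' h ∧ ord <+: ord' ∧ s'.reg 2 = h ∧ s'.reg 4 = v ∧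
      (∀ i, s'.arr 0 i = s₁.arr 0 i) ∧
      ∀ i, (hi : i < (adj v).length) → s₁.arr 0 v + i < j → (adj v)[i] ∈ ord')
      (fun _ => 8) (x := s₁.arr 0 v) (Nat.le_add_right _ (adj v).length) (by simp) (by simp)
      (by decide) ?_ ?_ ?_ ?_
    · refine ⟨ord, p, hs.congr ?_ rfl, hp, List.prefix_refl _, by simp [h2], by simp,
        fun _ => rfl, fun i hi hlt => by omega⟩
      intro r hr
      have : r ≠ 4 ∧ r ≠ 20 ∧ r ≠ 21 ∧ r ≠ 23 := by omega
      simp [this]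
    · rintro j s' m ⟨ord', p', hs', hp', hpre, h2', h4', h0', hmem⟩
      refine ⟨ord', p', hs'.congr ?_ rfl, hp', hpre, by simp [h2'], by simp [h4'], h0', hmem⟩
      intro r hr
      have : r ≠ 20 := by omega
      simp [this]
    · rintro j s₂ k₂ hj hj' hr hr' ⟨ord', p', hs', hp', hpre, h2', h4', h0', hmem⟩
      obtain ⟨i, rfl⟩ := Nat.exists_eq_add_of_le hj
      have hi : i < (adj v).length := by omega
      have hv' : ord'[h]? = some v := getElem?_of_prefix hpre hv
      refine runs_visit hs' hp' h4' hv' (w := (adj v)[i]) ?_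
        (((hadj v).2 _).1 (List.getElem_mem hi)) ?_
      · rw [hr, ← h0', hs'.input.nbr v i hi]
      · intro s₃ k₃ ord₃ p₃ hs₃ hp₃ hw hpre₃ hreg h0₃ hk₃
        refine ⟨by rw [hreg 20 (by omega) (by omega), hr],
          by rw [hreg 21 (by omega) (by omega), hr'],
          ⟨ord₃, p₃, hs₃, hp₃, hpre.trans hpre₃, by rw [hreg 2 (by omega) (by omega), h2'],
          by rw [hreg 4 (by omega) (by omega), h4'], fun i => by rw [h0₃, h0'], ?_⟩, hk₃⟩
        intro i' hi' hlt'
        rcases (by omega : i' = i ∨ i' < i) with rfl | hlt'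
        · exact hw
        · exact hpre₃.subset (hmem i' hi' (by omega))
    · rintro s₂ k₂ ⟨ord', p', hs', hp', hpre, h2', h4', h0', hmem⟩ hk₂
      have hv' : ord'[h]? = some v := getElem?_of_prefix hpre hv
      refine ⟨⟨ord', p', h + 1, hs'.congr ?_ rfl, hp'.advance hv' fun w hw => ?_, by simp [h2'],
        ?_⟩, ?_⟩
      · intro r hr
        have : r ≠ 2 := by omega
        simp [this]
      · obtain ⟨i, hi, rfl⟩ := List.getElem_of_mem (((hadj v).2 w).2 hw)
        exact hmem i hi (by omega)
      · have htake : ord'.take h = ord.take h := by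
          obtain ⟨t, rfl⟩ := hpre
          rw [List.take_append_of_le_length hlt.le]
        rw [List.take_add_one, hv', htake, List.map_append, List.sum_append]
        simp only [Finset.sum_const, Nat.card_Ico, smul_eq_mul] at hk₂
        simp only [Option.toList_some, List.map_cons, List.map_nil, List.sum_cons, List.sum_nil]
        omega
      · simp only [h2']
        omega
  · rintro s₁ k₁ ⟨ord, p, h, hs, hp, h2, hk⟩ hlt
    rw [holds_lt, h2, hs.tail] at hlt
    have hle := hp.le_length
    obtain rfl : h = ord.length := by omega
    rw [List.take_length] at hk
    have hsum := sum_map_le_sum_univ hp.nodup fun v => 12 * (adj v).length + 10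
    by_cases hlen : ord.length = n
    · exact hQ _ _ _ p (hp.hasTree hs hlen) hs.colors (hs.tail.trans hlen) (by omega)
    · refine hfail _ _ hs.input (by rw [hs.tail]; exact hlen) (fun hcon => hlen ?_) (by omega)
      have : ord.toFinset = Finset.univ :=
        Finset.eq_univ_of_forall fun v => List.mem_toFinset.2 (hp.mem_of_connected hcon v)
      rw [← List.toFinset_card_of_nodup hp.nodup, this, Finset.card_univ, Fintype.card_fin]

end Search

section Passes

variable {n : ℕ} {adj : Fin n → List (Fin n)} {G : SimpleGraph (Fin n)} {s s' : RAMState} {k : ℕ}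
  {root : Fin n} {pos : Fin n → ℕ} {p : Fin n → Fin n} {c : Fin n → Option Bool}

/-! ### The coloring and output programs -/

lemma HasTree.congr (h : HasTree G adj root pos p s)
    (hr : ∀ r, r < 2 ∨ r = 14 → s'.reg r = s.reg r)
    (ha : ∀ a i, a < 2 ∨ a = 5 ∨ a = 6 → s'.arr a i = s.arr a i) : HasTree G adj root pos p s' :=
  ⟨h.input.congr hr (fun a i ha' => ha a i (by omega)), h.tree, h.pos_lt, h.surj,
    fun v => by rw [ha _ _ (by omega), h.par], fun v => by rw [ha _ _ (by omega), h.order]⟩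

lemma HasTree.pos_root (h : HasTree G adj root pos p s) : pos root = 0 := by
  obtain ⟨v, hv⟩ := h.surj 0 root.pos
  by_cases e : v = root
  · exact e ▸ hv
  · have := h.tree.root_lt e
    omega

lemma HasTree.ne_root (h : HasTree G adj root pos p s) {v : Fin n} (hv : 1 ≤ pos v) :
    v ≠ root := by
  rintro rfl
  have := h.pos_root
  omega

/-- Siblings are the neighbors with the same entry in the parent array; the root is never among
them, since its mark `n + 1` differs from all other entries. -/
lemma HasTree.isSibling_iff (h : HasTree G adj root pos p s) (hadj : IsAdjacencyList G adj)
    {v w : Fin n} (hv : v ≠ root) :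
    IsSibling G root p v w ↔ w ∈ adj v ∧ s.arr 5 w = s.arr 5 v := by
  rw [(hadj v).2, h.par, h.par, if_neg hv, IsSibling]
  by_cases hw : w = root
  · have := (p v).2
    simp only [hw, if_true, ne_eq, not_true, false_and, false_iff]
    omega
  · rw [if_neg hw, Nat.add_right_cancel_iff, ← Fin.ext_iff]
    tauto

lemma colorCode_injective : Function.Injective colorCode := by
  intro a b h
  rcases a with _ | _ | _ <;> rcases b with _ | _ | _ <;> simp_all [colorCode]

/-- The result of a search for a sibling of `v` with the color `x`. -/
def SiblingResult (G : SimpleGraph (Fin n)) (root : Fin n) (p : Fin n → Fin n)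
    (c : Fin n → Option Bool) (v : Fin n) (x : Option Bool) (r : ℕ) : Prop :=
  (r = 0 ∧ ∀ w, IsSibling G root p v w → c w ≠ x) ∨
    ∃ w, IsSibling G root p v w ∧ c w = x ∧ r = w + 1

lemma runs_scanSiblings_of_hasTree {Q : RAMState → ℕ → Prop} (h : HasTree G adj root pos p s)
    (hadj : IsAdjacencyList G adj) (hc : HasColors c s) {v : Fin n} (hv : v ≠ root)
    (h4 : s.reg 4 = v) {x : Option Bool} (h10 : s.reg 10 = colorCode x)
    (hQ : ∀ s' k', HasTree G adj root pos p s' → HasColors c s' → s'.arr = s.arr →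
      (∀ r < 20, s'.reg r = s.reg r) → SiblingResult G root p c v x (s'.reg 25) →
      k' ≤ k + 12 * (adj v).length + 10 → Q s' k') :
    Runs scanSiblings s k Q := by
  refine runs_scanSiblings h.input h4 fun s' k' harr hreg hres hk => ?_
  refine hQ s' k' (h.congr (fun r hr => hreg r (by omega)) (by simp [harr]))
    (fun w => by rw [harr]; exact hc w) harr hreg ?_ hk
  rw [h10] at hres
  refine hres.imp (fun hres => ⟨hres.1, fun w hw hcw => ?_⟩) ?_
  · rw [h.isSibling_iff hadj hv] at hw
    exact hres.2 w hw.1 hw.2 (by rw [hc w, hcw])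
  · rintro ⟨w, hw, hpw, hcw, hr⟩
    rw [hc w] at hcw
    exact ⟨w, (h.isSibling_iff hadj hv).2 ⟨hw, hpw⟩, colorCode_injective hcw, hr⟩

lemma HasColors.update (hc : HasColors c s) {a m : ℕ} {v : Fin n} {x : Option Bool}
    (ha : a = v) (hm : m = colorCode x) :
    HasColors (Function.update c v x) (s.setArr 4 a m) := by
  intro w
  by_cases e : w = v
  · subst e
    simp [ha, hm]
  · have : (w : ℕ) ≠ v := fun e' => e (Fin.ext e')
    simp [e, ha, this, hc w]

/-- Set register 10 to the code of the color opposite to the one in register 16. -/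
def oppositeColor : Program := .seq (.const 10 1) (.ite (.eq 16 10) (.inc 10) .skip)

lemma runs_oppositeColor {Q : RAMState → ℕ → Prop} {b : Bool} (h : s.reg 16 = colorCode (some b))
    (hQ : ∀ s' k', s'.arr = s.arr → (∀ r, r ≠ 10 → s'.reg r = s.reg r) →
      s'.reg 10 = colorCode (some !b) → k' ≤ k + 3 → Q s' k') : Runs oppositeColor s k Q := by
  simp only [oppositeColor, runs_seq, runs_const, runs_ite, runs_inc, runs_skip, holds_eq,
    setReg_reg, Nat.reduceEqDiff, if_true, if_false, h]
  cases b
  · refine ⟨fun e => absurd e (by decide), fun _ => hQ _ _ rfl (fun r hr => by simp [hr]) ?_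
      (by omega)⟩
    simp [colorCode]
  · refine ⟨fun _ => hQ _ _ rfl (fun r hr => by simp [hr]) ?_ (by omega), fun e => absurd rfl e⟩
    simp [colorCode]

/-- If the vertex at the position in register 2 and all its siblings have the same color, give
their parent the other color, or set register 13 if the parent has the same color too. -/
def forceParent : Program :=
  .seq (.load 4 6 2) <| .seq (.load 16 4 4) <| .ite (.eq 16 14) .skip <|
  .seq (.const 10 0) <| .seq scanSiblings <| .ite (.eq 25 14)
    (.seq oppositeColor <| .seq scanSiblings <| .ite (.eq 25 14)
      (.seq (.load 17 5 4) <| .seq (.dec 17) <| .seq (.load 18 4 17) <|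
        .ite (.eq 18 14) (.store 4 17 10) (.ite (.eq 18 16) (.const 13 1) .skip))
      .skip)
    .skip

/-- The bottom-up pass. -/
def bottomUp : Program :=
  .seq (.const 13 0) <| .seq (.copy 2 0) <| .seq (.const 3 1) <| forDown 2 3 forceParent

lemma runs_forceParent {Q : RAMState → ℕ → Prop} (h : HasTree G adj root pos p s)
    (hG : IsBlockGraph G) (hadj : IsAdjacencyList G adj) (hc : HasColors c s)
    (hinv : IsForcedInvariant G c) {v : Fin n} (hv : v ≠ root) (h2 : s.reg 2 = pos v)
    (hQ : ∀ s' k' c', HasTree G adj root pos p s' → HasColors c' s' → IsForcedInvariant G c' →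
      (∀ w, w ≠ p v → c' w = c w) → (∀ w b, c w = some b → c' w = some b) →
      (∀ r, r = 2 ∨ r = 3 → s'.reg r = s.reg r) →
      ((s'.reg 13 = s.reg 13 ∧ ∀ b, c v = some b →
        (∀ w, IsSibling G root p v w → c w = some b) → c' (p v) = some (!b)) ∨
        (s'.reg 13 = 1 ∧ ¬ ∃ T, IsSpanningEvenTree G T)) →
      k' ≤ k + 24 * (adj v).length + 40 → Q s' k') :
    Runs forceParent s k Q := by
  have : Nontrivial (Fin n) := ⟨v, root, hv⟩
  simp only [forceParent, runs_seq, runs_load, runs_const, runs_ite, runs_skip, runs_dec,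
    runs_store, holds_eq, setReg_reg, setReg_arr, Nat.reduceEqDiff, if_true, if_false, h2,
    h.order, hc v, h.input.zero]
  have h0 : HasTree G adj root pos p ((s.setReg 4 v).setReg 16 (colorCode (c v))) := by
    refine h.congr (fun r hr => ?_) (fun _ _ _ => rfl)
    have : r ≠ 4 ∧ r ≠ 16 := by omega
    simp [this]
  refine ⟨fun hcv => ?_, fun hcv => ?_⟩
  · have hcv : c v = none := colorCode_injective hcv
    refine hQ _ _ c h0 hc hinv (fun _ _ => rfl) (fun _ _ => id) ?_ (.inl ⟨by simp, ?_⟩) (by omega)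
    · rintro r (rfl | rfl) <;> simp
    · intro b hb
      simp [hcv] at hb
  obtain ⟨b, hb⟩ : ∃ b, c v = some b := Option.ne_none_iff_exists'.1 fun e => hcv (by rw [e]; rfl)
  refine runs_scanSiblings_of_hasTree (pos := pos) (p := p) (v := v) (c := c) (x := none)
    ?_ hadj hc hv (by simp) (by simp [colorCode]) ?_
  · refine h0.congr (fun r hr => ?_) (fun _ _ _ => rfl)
    have : r ≠ 10 := by omega
    simp [this]
  intro s₁ k₁ ht₁ hc₁ harr₁ hreg₁ hres₁ hk₁
  have h23₁ : ∀ r, r = 2 ∨ r = 3 ∨ r = 13 → s₁.reg r = s.reg r := by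
    rintro r (rfl | rfl | rfl) <;> simp [hreg₁]
  have h4₁ : s₁.reg 4 = v := by simp [hreg₁]
  have h16₁ : s₁.reg 16 = colorCode (some b) := by simp [hreg₁, hb]
  rw [ht₁.input.zero]
  -- Some sibling is uncolored or has the other color: the parent is not forced.
  have hnone : ∀ s' k' x, HasTree G adj root pos p s' → HasColors c s' →
      (∀ r, r = 2 ∨ r = 3 ∨ r = 13 → s'.reg r = s.reg r) → x ≠ some b →
      SiblingResult G root p c v x (s'.reg 25) → s'.reg 25 ≠ 0 →
      k' ≤ k + 24 * (adj v).length + 40 → Q s' k' := by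
    intro s' k' x ht' hc' hreg' hx hres' h25 hk'
    rcases hres' with ⟨e, -⟩ | ⟨w, hw, hcw, -⟩
    · exact absurd e h25
    refine hQ s' k' c ht' hc' hinv (fun _ _ => rfl) (fun _ _ => id)
      (fun r hr => hreg' r (by omega)) (.inl ⟨hreg' 13 (by omega), fun b' hb' hsib => ?_⟩) hk'
    rw [hb] at hb'
    exact absurd ((hcw.symm.trans (hsib w hw)).trans hb'.symm) hx
  refine ⟨fun h25 => ?_, fun h25 => hnone s₁ _ none ht₁ hc₁ h23₁ (by simp) hres₁ h25 (by omega)⟩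
  refine runs_oppositeColor h16₁ fun s₂ k₂ harr₂ hreg₂ h10₂ hk₂ => ?_
  refine runs_scanSiblings_of_hasTree (pos := pos) (p := p) (v := v) (c := c) (x := some !b)
    (ht₁.congr (fun r hr => hreg₂ r (by omega)) (by simp [harr₂])) hadj
    (fun w => by rw [harr₂]; exact hc₁ w) hv (by rw [hreg₂ 4 (by omega), h4₁]) h10₂ ?_
  intro s₃ k₃ ht₃ hc₃ harr₃ hreg₃ hres₃ hk₃
  have hreg₃' : ∀ r < 20, r ≠ 10 → s₃.reg r = s₁.reg r := fun r hr hr' => by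
    rw [hreg₃ r hr, hreg₂ r hr']
  have h23₃ : ∀ r, r = 2 ∨ r = 3 ∨ r = 13 → s₃.reg r = s.reg r := fun r hr => by
    rw [hreg₃' r (by omega) (by omega), h23₁ r hr]
  have h4₃ : s₃.reg 4 = v := by rw [hreg₃' 4 (by omega) (by omega), h4₁]
  have h16₃ : s₃.reg 16 = colorCode (some b) := by rw [hreg₃' 16 (by omega) (by omega), h16₁]
  have h10₃ : s₃.reg 10 = colorCode (some !b) := by rw [hreg₃ 10 (by omega), h10₂]
  rw [ht₃.input.zero]
  refine ⟨fun h25' => ?_, fun h25' => hnone s₃ _ (some !b) ht₃ hc₃ h23₃ (by simp) hres₃ h25'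
    (by omega)⟩
  -- All siblings have the color `b` of `v`.
  have hsib : ∀ w, IsSibling G root p v w → c w = some b := by
    intro w hw
    rcases hres₁ with ⟨-, hres₁⟩ | ⟨w, -, -, e⟩
    swap
    · omega
    rcases hres₃ with ⟨-, hres₃⟩ | ⟨w, -, -, e⟩
    swap
    · omega
    have h1 := hres₁ w hw
    have h3 := hres₃ w hw
    cases e : c w with
    | none => exact absurd e h1
    | some x =>
      rw [e] at h3
      revert h3
      cases x <;> cases b <;> simp
  have hpar : s₃.arr 5 v = p v + 1 := by rw [ht₃.par, if_neg hv]
  simp only [h4₃, hpar, Nat.add_sub_cancel, hc₃ (p v), h16₃, h10₃]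
  have ht₄ : HasTree G adj root pos p
      (((s₃.setReg 17 (p v + 1)).setReg 17 (p v)).setReg 18 (colorCode (c (p v)))) := by
    refine ht₃.congr (fun r hr => ?_) (fun _ _ _ => rfl)
    have : r ≠ 17 ∧ r ≠ 18 := by omega
    simp [this]
  refine ⟨fun hp => ?_, fun hp => ⟨fun hp' => ?_, fun hp' => ?_⟩⟩
  · have hp : c (p v) = none := colorCode_injective hp
    have hstep := h.tree.forceStep hG hv hb hsib hp
    refine hQ _ _ (Function.update c (p v) (some !b)) (ht₄.congr (fun _ _ => rfl) ?_)
      (HasColors.update hc₃ rfl rfl) (hinv.forceStep hG h.tree.connected hstep)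
      (fun w hw => Function.update_of_ne hw _ _) (fun w x hw => ?_) ?_ (.inl ⟨?_, ?_⟩) (by omega)
    · intro a i ha
      have : a ≠ 4 := by omega
      simp [this]
    · rwa [Function.update_of_ne]
      rintro rfl
      simp [hp] at hw
    · rintro r (rfl | rfl) <;> simp [h23₃]
    · simp [h23₃]
    · intro b' hb' _
      rw [hb, Option.some.injEq] at hb'
      simp [hb']
  · have hp' : c (p v) = some b := colorCode_injective hp'
    refine hQ _ _ c (ht₄.congr (fun r hr => ?_) (fun _ _ _ => rfl)) hc₃ hinv (fun _ _ => rfl)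
      (fun _ _ => id) ?_
      (.inr ⟨by simp, h.tree.not_exists_isSpanningEvenTree hG hinv hv hb hsib hp'⟩) (by omega)
    · have : r ≠ 13 := by omega
      simp [this]
    · rintro r (rfl | rfl) <;> simp [h23₃]
  · refine hQ _ _ c ht₄ hc₃ hinv (fun _ _ => rfl) (fun _ _ => id) ?_ (.inl ⟨?_, ?_⟩) (by omega)
    · rintro r (rfl | rfl) <;> simp [h23₃]
    · simp [h23₃]
    · intro b' hb' _
      rw [hb, Option.some.injEq] at hb'
      subst hb'
      cases e : c (p v) with
      | none => exact absurd (by rw [e]; rfl) hp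
      | some x =>
        exact congrArg some (Bool.eq_not_of_ne fun e' => hp' (by rw [e, e']))

lemma runs_bottomUp {Q : RAMState → ℕ → Prop} (h : HasTree G adj root pos p s)
    (hG : IsBlockGraph G) (hadj : IsAdjacencyList G adj) (hc : HasColors c s)
    (hinv : IsForcedInvariant G c)
    (hfail : ∀ s' k', HasInput adj s' → s'.reg 13 ≠ 0 → (¬ ∃ T, IsSpanningEvenTree G T) →
      k' ≤ k + ∑ v, (24 * (adj v).length + 40) + 2 * n + 4 → Q s' k')
    (hQ : ∀ s' k' c', HasTree G adj root pos p s' → HasColors c' s' → s'.reg 13 = 0 →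
      IsForcedInvariant G c' → IsForcedFrom G root pos p 1 c' →
      k' ≤ k + ∑ v, (24 * (adj v).length + 40) + 2 * n + 4 → Q s' k') :
    Runs bottomUp s k Q := by
  have hn : 1 ≤ n := root.pos
  simp only [bottomUp, runs_seq, runs_const, runs_copy]
  refine Runs.forDown (fun j s' => HasTree G adj root pos p s' ∧ ∃ c', HasColors c' s' ∧
      IsForcedInvariant G c' ∧ ((s'.reg 13 = 0 ∧ IsForcedFrom G root pos p j c') ∨
        (s'.reg 13 = 1 ∧ ¬ ∃ T, IsSpanningEvenTree G T)))
    (fun j => ∑ v with pos v = j, (24 * (adj v).length + 40)) hn (by simp [h.input.size])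
    (by simp) (by decide) ?_ ?_ ?_ ?_
  · refine ⟨h.congr (fun r hr => ?_) (fun _ _ _ => rfl), c, hc, hinv, .inl ⟨by simp, ?_⟩⟩
    · have : r ≠ 13 ∧ r ≠ 2 ∧ r ≠ 3 := by omega
      simp [this]
    · intro v _ hv
      have := h.pos_lt v
      omega
  · rintro j s₁ m ⟨ht, c', hc', hor⟩
    refine ⟨ht.congr (fun r hr => ?_) (fun _ _ _ => rfl), c', hc', by simpa using hor⟩
    have : r ≠ 2 := by omega
    simp [this]
  · rintro j s₁ k₁ hj hj' hr hr' ⟨ht, c', hc', hinv', hor⟩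
    obtain ⟨v, rfl⟩ := h.surj j hj'
    refine runs_forceParent ht hG hadj hc' hinv' (ht.ne_root hj) hr ?_
    intro s₂ k₂ c₂ ht₂ hc₂ hinv₂ hsame hext hreg hor₂ hk₂
    refine ⟨by rw [hreg 2 (by simp), hr], by rw [hreg 3 (by simp), hr'],
      ⟨ht₂, c₂, hc₂, hinv₂, ?_⟩, ?_⟩
    · rcases hor₂ with ⟨h13, hclose⟩ | hno
      · rcases hor with ⟨h13', hfrom⟩ | ⟨h13', hno⟩
        · refine .inl ⟨h13.trans h13', hfrom.step ht.tree.inj rfl (fun w hw => hsame w ?_) hext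
            hclose⟩
          rintro rfl
          have := ht.tree.lt v (ht.ne_root hj)
          omega
        · exact .inr ⟨h13.trans h13', hno⟩
      · exact .inr hno
    · refine hk₂.trans ?_
      have := Finset.single_le_sum (f := fun v => 24 * (adj v).length + 40)
        (fun _ _ => Nat.zero_le _)
        (Finset.mem_filter.2 ⟨Finset.mem_univ v, rfl⟩ : v ∈ Finset.univ.filter (pos · = pos v))
      omega
  · rintro s₁ k₁ ⟨ht, c', hc', hinv', hor⟩ hk
    have hsum := sum_Ico_charge_le pos (fun v => 24 * (adj v).length + 40) 1 n
    rw [Finset.sum_add_distrib] at hk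
    simp only [Finset.sum_const, Nat.card_Ico, smul_eq_mul] at hk
    rcases hor with ⟨h13, hfrom⟩ | ⟨h13, hno⟩
    · exact hQ s₁ k₁ c' ht hc' h13 hinv' hfrom (by omega)
    · exact hfail s₁ k₁ ht.input (by omega) hno (by omega)

end Passes

section TopDownAndOutput

variable {n : ℕ} {adj : Fin n → List (Fin n)} {G : SimpleGraph (Fin n)} {s s' : RAMState} {k : ℕ}
  {root : Fin n} {pos : Fin n → ℕ} {p : Fin n → Fin n} {c c₁ : Fin n → Option Bool}

/-- If the vertex at the position in register 2 is uncolored, color it black if its parent or a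
sibling is white, and white otherwise. -/
def fillVertex : Program :=
  .seq (.load 4 6 2) <| .seq (.load 16 4 4) <| .ite (.eq 16 14)
    (.seq (.const 10 2) <| .seq scanSiblings <|
      .seq (.load 17 5 4) <| .seq (.dec 17) <| .seq (.load 18 4 17) <| .seq (.const 16 1) <|
      .seq (.ite (.eq 25 14) (.ite (.eq 18 10) .skip (.inc 16)) .skip) (.store 4 4 16))
    .skip

/-- Color the root black if it is uncolored. -/
def fillRoot : Program :=
  .seq (.copy 4 0) <| .seq (.dec 4) <| .seq (.load 16 4 4) <|
    .ite (.eq 16 14) (.seq (.const 16 1) (.store 4 4 16)) .skip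

/-- The top-down pass. -/
def topDown : Program := .seq fillRoot <| .seq (.const 2 1) <| forUp 2 0 fillVertex

lemma runs_fillVertex {Q : RAMState → ℕ → Prop} (h : HasTree G adj root pos p s)
    (hadj : IsAdjacencyList G adj) (hc : HasColors c s) {v : Fin n} (hv : v ≠ root)
    (h2 : s.reg 2 = pos v) (hfill : IsFilledBelow G root pos p c₁ (pos v) c)
    (hQ : ∀ s' k' c', HasTree G adj root pos p s' → HasColors c' s' →
      IsFilledBelow G root pos p c₁ (pos v + 1) c' → s'.reg 2 = s.reg 2 →
      k' ≤ k + 12 * (adj v).length + 22 → Q s' k') :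
    Runs fillVertex s k Q := by
  simp only [fillVertex, runs_seq, runs_load, runs_const, runs_ite, runs_skip, runs_dec, runs_inc,
    runs_store, holds_eq, setReg_reg, setReg_arr, Nat.reduceEqDiff, if_true, if_false, h2,
    h.order, hc v, h.input.zero]
  have h0 : HasTree G adj root pos p ((s.setReg 4 v).setReg 16 (colorCode (c v))) := by
    refine h.congr (fun r hr => ?_) (fun _ _ _ => rfl)
    have : r ≠ 4 ∧ r ≠ 16 := by omega
    simp [this]
  refine ⟨fun hcv => ?_, fun hcv => ?_⟩
  swap
  · refine hQ _ _ c h0 hc (hfill.step_of_some h.tree.inj rfl fun e => hcv (by rw [e]; rfl))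
      (by simp [h2]) (by omega)
  have hcv : c v = none := colorCode_injective hcv
  refine runs_scanSiblings_of_hasTree (pos := pos) (p := p) (v := v) (c := c) (x := some false)
    ?_ hadj hc hv (by simp) (by simp [colorCode]) ?_
  · refine h0.congr (fun r hr => ?_) (fun _ _ _ => rfl)
    have : r ≠ 10 := by omega
    simp [this]
  intro s₁ k₁ ht₁ hc₁ harr₁ hreg₁ hres₁ hk₁
  have h4₁ : s₁.reg 4 = v := by simp [hreg₁]
  have h10₁ : s₁.reg 10 = colorCode (some false) := by simp [hreg₁, colorCode]
  have h2₁ : s₁.reg 2 = pos v := by simp [hreg₁, h2]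
  have hpar : s₁.arr 5 v = p v + 1 := by rw [ht₁.par, if_neg hv]
  simp only [h4₁, hpar, Nat.add_sub_cancel, hc₁ (p v), h10₁, ht₁.input.zero]
  have hfinish : ∀ x k' s', HasTree G adj root pos p s' → HasColors c s' → s'.reg 2 = pos v →
      (x = false ↔ c (p v) ≠ some false ∧ ∀ w, IsSibling G root p v w → c w ≠ some false) →
      k' ≤ k + 12 * (adj v).length + 22 → ∀ m, m = colorCode (some x) →
      Q (s'.setArr 4 v m) k' := by
    intro x k' s' ht' hc' h2' hx hk' m hm
    refine hQ _ _ _ (ht'.congr (fun _ _ => rfl) ?_) (hc'.update rfl hm)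
      (hfill.step_of_none h.tree rfl hv hcv hx) (by simp [h2', h2]) hk'
    intro a i ha
    have : a ≠ 4 := by omega
    simp [this]
  have hbase : ∀ m, HasTree G adj root pos p ((((s₁.setReg 17 (p v + 1)).setReg 17 (p v)).setReg 18
      (colorCode (c (p v)))).setReg 16 m) := by
    intro m
    refine ht₁.congr (fun r hr => ?_) (fun _ _ _ => rfl)
    have : r ≠ 17 ∧ r ≠ 18 ∧ r ≠ 16 := by omega
    simp [this]
  have hbase' : ∀ m m', HasTree G adj root pos p (((((s₁.setReg 17 (p v + 1)).setReg 17
      (p v)).setReg 18 (colorCode (c (p v)))).setReg 16 m).setReg 16 m') := by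
    intro m m'
    refine (hbase m).congr (fun r hr => ?_) (fun _ _ _ => rfl)
    have : r ≠ 16 := by omega
    simp [this]
  refine ⟨fun h25 => ?_, fun h25 => ?_⟩
  · have hsib : ∀ w, IsSibling G root p v w → c w ≠ some false := by
      rcases hres₁ with ⟨-, hres₁⟩ | ⟨w, -, -, e⟩
      · exact hres₁
      · omega
    refine ⟨fun hp => ?_, fun hp => ?_⟩
    · have hp : c (p v) = some false := colorCode_injective hp
      exact hfinish true _ _ (hbase _) hc₁ (by simp [h2₁]) (by simp [hp]) (by omega) _ rfl
    · have hp : c (p v) ≠ some false := fun e => hp (by rw [e])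
      exact hfinish false _ _ (hbase' _ _) hc₁ (by simp [h2₁]) (by simpa [hp] using hsib)
        (by omega) _ rfl
  · obtain ⟨w, hw, hcw⟩ : ∃ w, IsSibling G root p v w ∧ c w = some false := by
      rcases hres₁ with ⟨e, -⟩ | ⟨w, hw, hcw, -⟩
      · exact absurd e h25
      · exact ⟨w, hw, hcw⟩
    refine hfinish true _ _ (hbase _) hc₁ (by simp [h2₁]) ?_ (by omega) _ rfl
    simp only [Bool.true_eq_false, false_iff, not_and]
    exact fun _ hs => hs w hw hcw

/-- After the treatment of the root, the top-down pass is done with position 0. -/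
lemma isFilledBelow_start (h : HasTree G adj root pos p s) :
    IsFilledBelow G root pos p c₁ 1
      (if c₁ root = none then Function.update c₁ root (some true) else c₁) := by
  have hroot : ∀ v, pos v < 1 → v = root := fun v hv =>
    h.tree.inj (by rw [h.pos_root]; omega)
  have hne : ∀ v, 1 ≤ pos v → v ≠ root := fun v hv => h.ne_root hv
  split_ifs with hr
  · refine ⟨fun v b hv => ?_, fun v hv => Function.update_of_ne (hne v hv) _ _, fun v hv => ?_,
      fun _ => by simp, fun v hv hi => absurd (hroot v hi) hv⟩
    · rwa [Function.update_of_ne]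
      rintro rfl
      simp [hr] at hv
    · simp [hroot v hv]
  · exact ⟨fun _ _ => id, fun _ _ => rfl, fun v hv => hroot v hv ▸ hr, fun e => absurd e hr,
      fun v hv hi => absurd (hroot v hi) hv⟩

lemma runs_fillRoot {Q : RAMState → ℕ → Prop} (h : HasTree G adj root pos p s)
    (hroot : (root : ℕ) = n - 1) (hc : HasColors c₁ s)
    (hQ : ∀ s' k' c', HasTree G adj root pos p s' → HasColors c' s' →
      IsFilledBelow G root pos p c₁ 1 c' → k' ≤ k + 6 → Q s' k') :
    Runs fillRoot s k Q := by
  simp only [fillRoot, runs_seq, runs_load, runs_const, runs_copy, runs_ite, runs_skip, runs_dec,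
    runs_store, holds_eq, setReg_reg, setReg_arr, Nat.reduceEqDiff, if_true, if_false,
    h.input.zero, h.input.size, ← hroot, hc root]
  have hstart := isFilledBelow_start (c₁ := c₁) h
  refine ⟨fun hr => ?_, fun hr => ?_⟩
  · have hr : c₁ root = none := colorCode_injective hr
    rw [if_pos hr] at hstart
    refine hQ _ _ _ (h.congr (fun r hr => ?_) ?_) (HasColors.update hc rfl rfl) hstart (by omega)
    · have : r ≠ 4 ∧ r ≠ 16 := by omega
      simp [this]
    · intro a i ha
      have : a ≠ 4 := by omega
      simp [this]
  · rw [if_neg fun e => hr (by rw [e]; rfl)] at hstart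
    refine hQ _ _ _ (h.congr (fun r hr => ?_) (fun _ _ _ => rfl)) hc hstart (by omega)
    have : r ≠ 4 ∧ r ≠ 16 := by omega
    simp [this]

lemma runs_topDown {Q : RAMState → ℕ → Prop} (h : HasTree G adj root pos p s)
    (hadj : IsAdjacencyList G adj) (hroot : (root : ℕ) = n - 1) (hc : HasColors c₁ s)
    (hQ : ∀ s' k' c', HasTree G adj root pos p s' → HasColors c' s' →
      IsFilledBelow G root pos p c₁ n c' →
      k' ≤ k + ∑ v, (12 * (adj v).length + 22) + 2 * n + 8 → Q s' k') :
    Runs topDown s k Q := by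
  have hn : 1 ≤ n := root.pos
  simp only [topDown, runs_seq, runs_const]
  refine runs_fillRoot h hroot hc fun s₀ k₀ c₀ ht₀ hc₀ hfill₀ hk₀ => ?_
  refine Runs.forUp (fun j s' => HasTree G adj root pos p s' ∧ ∃ c', HasColors c' s' ∧
      IsFilledBelow G root pos p c₁ j c')
    (fun j => ∑ v with pos v = j, (12 * (adj v).length + 22)) hn (by simp)
    (by simp [ht₀.input.size]) (by decide) ?_ ?_ ?_ ?_
  · refine ⟨ht₀.congr (fun r hr => ?_) (fun _ _ _ => rfl), c₀, hc₀, hfill₀⟩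
    have : r ≠ 2 := by omega
    simp [this]
  · rintro j s₁ m ⟨ht, c', hc', hfill⟩
    refine ⟨ht.congr (fun r hr => ?_) (fun _ _ _ => rfl), c', hc', hfill⟩
    have : r ≠ 2 := by omega
    simp [this]
  · rintro j s₁ k₁ hj hj' hr hr' ⟨ht, c', hc', hfill⟩
    obtain ⟨v, rfl⟩ := h.surj j hj'
    refine runs_fillVertex ht hadj hc' (ht.ne_root hj) hr hfill ?_
    intro s₂ k₂ c₂ ht₂ hc₂ hfill₂ hreg hk₂
    refine ⟨hreg.trans hr, ht₂.input.size, ⟨ht₂, c₂, hc₂, hfill₂⟩, hk₂.trans ?_⟩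
    have := Finset.single_le_sum (f := fun v => 12 * (adj v).length + 22) (fun _ _ => Nat.zero_le _)
      (Finset.mem_filter.2 ⟨Finset.mem_univ v, rfl⟩ : v ∈ Finset.univ.filter (pos · = pos v))
    omega
  · rintro s₁ k₁ ⟨ht, c', hc', hfill⟩ hk
    have hsum := sum_Ico_charge_le pos (fun v => 12 * (adj v).length + 22) 1 n
    rw [Finset.sum_add_distrib] at hk
    simp only [Finset.sum_const, Nat.card_Ico, smul_eq_mul] at hk
    exact hQ s₁ k₁ c' ht hc' hfill (by omega)

/-- Output the edge from the vertex in register 2 to its parent, or, if these have the same color,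
to a sibling of the other color. -/
def linkVertex : Program :=
  .seq (.copy 4 2) <| .seq (.load 16 4 4) <| .seq oppositeColor <| .seq scanSiblings <|
  .seq (.load 17 5 4) <| .seq (.dec 17) <| .seq (.load 18 4 17) <|
  .seq (.ite (.eq 18 16) (.seq (.copy 17 25) (.dec 17)) .skip) <|
  .seq (.store 2 2 2) (.store 3 2 17)

/-- Output an edge for each vertex but the root `n - 1`. -/
def outputLinks : Program :=
  .seq (.copy 3 0) <| .seq (.dec 3) <| .seq (.const 2 0) <| forUp 2 3 linkVertex

lemma runs_linkVertex {Q : RAMState → ℕ → Prop} (h : HasTree G adj root pos p s)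
    (hG : IsBlockGraph G) (hadj : IsAdjacencyList G adj) {d : Fin n → Bool}
    (hd : IsGoodColoring G d) (hc : HasColors (fun v => some (d v)) s) {v : Fin n} (hv : v ≠ root)
    (h2 : s.reg 2 = v)
    (hQ : ∀ s' k' u, HasTree G adj root pos p s' → HasColors (fun v => some (d v)) s' →
      (d (p v) ≠ d v ∧ u = p v) ∨ (d (p v) = d v ∧ IsSibling G root p v u ∧ d u ≠ d v) →
      (∀ r, r = 2 ∨ r = 3 → s'.reg r = s.reg r) →
      (∀ i, s'.arr 2 i = if i = v then (v : ℕ) else s.arr 2 i) →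
      (∀ i, s'.arr 3 i = if i = v then (u : ℕ) else s.arr 3 i) →
      k' ≤ k + 12 * (adj v).length + 24 → Q s' k') :
    Runs linkVertex s k Q := by
  simp only [linkVertex, runs_seq, runs_load, runs_copy, runs_ite, runs_skip, runs_dec,
    runs_store, holds_eq, setReg_reg, setReg_arr, Nat.reduceEqDiff, if_true, if_false, h2, hc v]
  have h0 : HasTree G adj root pos p ((s.setReg 4 v).setReg 16 (colorCode (some (d v)))) := by
    refine h.congr (fun r hr => ?_) (fun _ _ _ => rfl)
    have : r ≠ 4 ∧ r ≠ 16 := by omega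
    simp [this]
  refine runs_oppositeColor (b := d v) (by simp) fun s₁ k₁ harr₁ hreg₁ h10₁ hk₁ => ?_
  have ht₁ := h0.congr (fun r hr => hreg₁ r (by omega)) (by simp [harr₁])
  refine runs_scanSiblings_of_hasTree (v := v) (c := fun v => some (d v)) (x := some !d v) ht₁
    hadj (fun w => by rw [harr₁]; exact hc w) hv (by rw [hreg₁ 4 (by omega)]; simp) h10₁ ?_
  intro s₂ k₂ ht₂ hc₂ harr₂ hreg₂ hres₂ hk₂
  have hreg₂' : ∀ r < 20, r ≠ 10 → r ≠ 4 → r ≠ 16 → s₂.reg r = s.reg r := by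
    intro r hr h10 h4 h16
    rw [hreg₂ r hr, hreg₁ r h10]
    simp [h4, h16]
  have harr₂' : s₂.arr = s.arr := harr₂.trans harr₁
  have h4₂ : s₂.reg 4 = v := by rw [hreg₂ 4 (by omega), hreg₁ 4 (by omega)]; simp
  have h16₂ : s₂.reg 16 = colorCode (some (d v)) := by
    rw [hreg₂ 16 (by omega), hreg₁ 16 (by omega)]; simp
  have h2₂ : s₂.reg 2 = v := by rw [hreg₂' 2 (by omega) (by omega) (by omega) (by omega), h2]
  have hpar : s₂.arr 5 v = p v + 1 := by rw [ht₂.par, if_neg hv]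
  simp only [h4₂, hpar, Nat.add_sub_cancel, hc₂ (p v), h16₂, h2₂, setArr_reg, setReg_reg,
    Nat.reduceEqDiff, if_true, if_false]
  have hfinish : ∀ (u : Fin n) k' s', HasTree G adj root pos p s' → s'.arr = s₂.arr →
      (∀ r, r = 2 ∨ r = 3 → s'.reg r = s₂.reg r) →
      (d (p v) ≠ d v ∧ u = p v) ∨ (d (p v) = d v ∧ IsSibling G root p v u ∧ d u ≠ d v) →
      k' ≤ k + 12 * (adj v).length + 24 → ∀ m : ℕ, m = u →
      Q ((s'.setArr 2 v v).setArr 3 v m) k' := by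
    intro u k' s' ht' harr' hreg' hu hk' m hm
    refine hQ _ _ u (ht'.congr (fun _ _ => rfl) ?_) (fun w => ?_) hu (fun r hr => ?_)
      (fun i => ?_) (fun i => ?_) hk'
    · intro a i ha
      have : a ≠ 2 ∧ a ≠ 3 := by omega
      simp [this]
    · simpa [harr'] using hc₂ w
    · rw [setArr_reg, setArr_reg, hreg' r hr, hreg₂' r] <;> omega
    · simp [harr', harr₂']
    · simp [harr', harr₂', hm]
  refine ⟨fun hp => ?_, fun hp => ?_⟩
  · have hp : d (p v) = d v := Option.some.inj (colorCode_injective hp)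
    obtain ⟨x, hx, hdx⟩ := h.tree.exists_sibling_ne hG hd hv hp
    rcases hres₂ with ⟨-, hres₂⟩ | ⟨u, hu, hdu, h25⟩
    · exact absurd (congrArg some hdx) (hres₂ x hx)
    · have hdu : d u = !d v := Option.some.inj hdu
      refine hfinish u _ _ (ht₂.congr ?_ ?_) ?_ ?_ (.inr ⟨hp, hu, by simp [hdu]⟩) ?_ _ ?_
      · intro r hr
        have : r ≠ 17 ∧ r ≠ 18 := by omega
        simp [this]
      · exact fun _ _ _ => rfl
      · rfl
      · rintro r (rfl | rfl) <;> simp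
      · omega
      · simp [h25]
  · have hp : d (p v) ≠ d v := fun e => hp (by rw [e])
    refine hfinish (p v) _ _ (ht₂.congr ?_ ?_) ?_ ?_ (.inl ⟨hp, rfl⟩) ?_ _ rfl
    · intro r hr
      have : r ≠ 17 ∧ r ≠ 18 := by omega
      simp [this]
    · exact fun _ _ _ => rfl
    · rfl
    · rintro r (rfl | rfl) <;> simp
    · omega

lemma runs_outputLinks {Q : RAMState → ℕ → Prop} (h : HasTree G adj root pos p s)
    (hG : IsBlockGraph G) (hadj : IsAdjacencyList G adj) (hroot : (root : ℕ) = n - 1)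
    {d : Fin n → Bool} (hd : IsGoodColoring G d) (hc : HasColors (fun v => some (d v)) s)
    (hQ : ∀ (s' : RAMState) (k' : ℕ) (q : Fin n → Fin n), IsLink G root p d q →
      (∀ v : Fin n, v ≠ root → s'.arr 2 v = (v : ℕ) ∧ s'.arr 3 v = (q v : ℕ)) →
      k' ≤ k + ∑ v, (12 * (adj v).length + 24) + 2 * n + 4 → Q s' k') :
    Runs outputLinks s k Q := by
  simp only [outputLinks, runs_seq, runs_const, runs_copy, runs_dec, setReg_reg, if_true,
    h.input.size]
  have hlt : ∀ v : Fin n, v ≠ root ↔ (v : ℕ) < n - 1 := fun v => by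
    rw [ne_eq, Fin.ext_iff, hroot]
    omega
  refine Runs.forUp (fun j s' => HasTree G adj root pos p s' ∧
      HasColors (fun v => some (d v)) s' ∧ ∃ q : Fin n → Fin n, ∀ v : Fin n, (v : ℕ) < j →
        (s'.arr 2 v = (v : ℕ) ∧ s'.arr 3 v = (q v : ℕ)) ∧ ((d (p v) ≠ d v ∧ q v = p v) ∨
          (d (p v) = d v ∧ IsSibling G root p v (q v) ∧ d (q v) ≠ d v)))
    (fun j => ∑ v : Fin n with v.val = j, (12 * (adj v).length + 24)) (Nat.zero_le (n - 1))
    (by simp) (by simp) (by decide) ?_ ?_ ?_ ?_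
  · refine ⟨h.congr (fun r hr => ?_) (fun _ _ _ => rfl), hc, id, fun v hv => by omega⟩
    have : r ≠ 2 ∧ r ≠ 3 := by omega
    simp [this]
  · rintro j s₁ m ⟨ht, hc', hq⟩
    refine ⟨ht.congr (fun r hr => ?_) (fun _ _ _ => rfl), hc', hq⟩
    have : r ≠ 2 := by omega
    simp [this]
  · rintro j s₁ k₁ hj hj' hr hr' ⟨ht, hc', q, hq⟩
    obtain ⟨v, rfl⟩ : ∃ v : Fin n, v.val = j := ⟨⟨j, by omega⟩, rfl⟩
    refine runs_linkVertex ht hG hadj hd hc' ((hlt v).2 hj') hr ?_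
    intro s₂ k₂ u ht₂ hc₂ hu hreg h2 h3 hk₂
    refine ⟨by rw [hreg 2 (by simp), hr], by rw [hreg 3 (by simp), hr'],
      ⟨ht₂, hc₂, Function.update q v u, fun w hw => ?_⟩, hk₂.trans ?_⟩
    · by_cases e : w = v
      · subst e
        simpa [h2, h3] using hu
      · have e' : (w : ℕ) ≠ v := fun e' => e (Fin.ext e')
        simpa [h2, h3, e, e'] using hq w (by omega)
    · have := Finset.single_le_sum (f := fun v => 12 * (adj v).length + 24)
        (fun _ _ => Nat.zero_le _) (Finset.mem_filter.2 ⟨Finset.mem_univ v, rfl⟩ :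
          v ∈ Finset.univ.filter fun w : Fin n => w.val = v.val)
      omega
  · rintro s₁ k₁ ⟨ht, hc', q, hq⟩ hk
    have hsum := sum_Ico_charge_le (Fin.val : Fin n → ℕ) (fun v => 12 * (adj v).length + 24) 0
      (n - 1)
    rw [Finset.sum_add_distrib] at hk
    simp only [Finset.sum_const, Nat.card_Ico, smul_eq_mul] at hk
    exact hQ s₁ k₁ q (fun v hv => (hq v ((hlt v).1 hv)).2) (fun v hv => (hq v ((hlt v).1 hv)).1)
      (by omega)

/-! ### The whole algorithm -/

/-- The linear-time algorithm for spanning even trees of block graphs. Registers: 0 the number of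
vertices, 1 the answer, 2 and 3 the outer loops, 4 the current vertex, 10 a color to be searched
for, 12 the length of the queue, 13 the failure of the bottom-up pass, 14 zero, 16 to 18 scratch,
20 to 25 the scan of an adjacency list. Arrays: 0 and 1 the input, 2 and 3 the output, 4 colors,
5 parents, 6 the queue. -/
def spanningEvenTreeProgram : Program :=
  -- The graph without vertices has no spanning tree.
  .ite (.lt 14 0)
    (.seq colorLeaves <| .seq search <| .ite (.eq 12 0)
      (.seq bottomUp <| .ite (.eq 13 14) (.seq topDown <| .seq outputLinks (.const 1 1)) .skip)
      .skip)
    .skip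

lemma sum_length_eq (hadj : IsAdjacencyList G adj) :
    ∑ v, (adj v).length = 2 * G.edgeSet.ncard := by
  classical
  have hdeg : ∀ v, (adj v).length = G.degree v := fun v => by
    rw [← List.toFinset_card_of_nodup (hadj v).1, ← card_neighborFinset_eq_degree]
    congr 1
    ext u
    simp [(hadj v).2 u]
  rw [Finset.sum_congr rfl fun v _ => hdeg v, sum_degrees_eq_twice_card_edges, ← coe_edgeFinset,
    Set.ncard_coe_finset]

lemma isCorrectOutput_of_isLink {d : Fin n → Bool} {q : Fin n → Fin n}
    (ht : IsSearchTree G root pos p) (hG : IsBlockGraph G) (hroot : (root : ℕ) = n - 1)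
    (hd : IsGoodColoring G d) (hq : IsLink G root p d q) (h1 : s.reg 1 = 1)
    (hout : ∀ v : Fin n, v ≠ root → s.arr 2 v = (v : ℕ) ∧ s.arr 3 v = (q v : ℕ)) :
    IsCorrectOutput G s := by
  refine .inl ⟨h1, linkGraph root q, hq.isSpanningEvenTree ht hG hd, fun u v => ?_⟩
  have hlt : ∀ v : Fin n, v ≠ root ↔ (v : ℕ) < n - 1 := fun v => by
    rw [ne_eq, Fin.ext_iff, hroot]
    omega
  constructor
  · rw [linkGraph, fromRel_adj]
    rintro ⟨-, ⟨h, rfl⟩ | ⟨h, rfl⟩⟩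
    · exact ⟨u, (hlt u).1 h, .inl (hout u h)⟩
    · exact ⟨v, (hlt v).1 h, .inr (hout v h)⟩
  · rintro ⟨i, hi, h⟩
    obtain ⟨w, rfl⟩ : ∃ w : Fin n, w.val = i := ⟨⟨i, by omega⟩, rfl⟩
    have hw := (hlt w).2 hi
    rw [(hout w hw).1, (hout w hw).2] at h
    rcases h with ⟨h, h'⟩ | ⟨h, h'⟩
    · rw [← Fin.ext h, ← Fin.ext h']
      exact hq.linkGraph_adj hw
    · rw [← Fin.ext h, ← Fin.ext h']
      exact (hq.linkGraph_adj hw).symm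

lemma runs_spanningEvenTreeProgram (hG : IsBlockGraph G) (hadj : IsAdjacencyList G adj) :
    Runs spanningEvenTreeProgram (inputState adj) 0 fun s t =>
      t ≤ 200 * (n + G.edgeSet.ncard + 1) ∧ IsCorrectOutput G s := by
  have hin := hasInput_inputState adj
  have hsum := sum_length_eq hadj
  simp only [spanningEvenTreeProgram, runs_ite, runs_skip, runs_seq, runs_const, holds_lt,
    holds_eq, hin.zero, hin.size]
  refine ⟨fun hn => ?_, fun hn => ⟨by omega, .inr ⟨hin.answer, ?_⟩⟩⟩
  swap
  · rintro ⟨T, hT⟩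
    obtain ⟨v⟩ := hT.2.1.connected.nonempty
    exact hn v.pos
  let root : Fin n := ⟨n - 1, by omega⟩
  have hroot : (root : ℕ) = n - 1 := rfl
  have htime : ∀ a b, ∑ v, (a * (adj v).length + b) = a * (2 * G.edgeSet.ncard) + n * b :=
    fun a b => by simp [Finset.sum_add_distrib, ← Finset.mul_sum, hsum]
  refine runs_colorLeaves hin hadj (by simp [inputState]) fun s₁ k₁ hin₁ hc₁ h5₁ hk₁ => ?_
  refine runs_search (root := root) hin₁ hadj hroot hc₁
    (fun i => by rw [h5₁]; simp [inputState]) ?_ ?_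
  · intro s₂ k₂ hin₂ h12 hcon hk₂
    rw [htime] at hk₂
    rw [hin₂.size]
    refine ⟨fun e => absurd e h12, fun _ => ⟨by omega, .inr ⟨hin₂.answer, ?_⟩⟩⟩
    rintro ⟨T, hT⟩
    exact hcon (hT.2.1.connected.mono hT.1)
  intro s₂ k₂ pos p ht₂ hc₂ h12 hk₂
  rw [htime] at hk₂
  rw [ht₂.input.size]
  refine ⟨fun _ => ?_, fun e => absurd h12 e⟩
  refine runs_bottomUp ht₂ hG hadj hc₂ isForcedInvariant_initialColoring ?_ ?_
  · intro s₃ k₃ hin₃ h13 hno hk₃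
    rw [htime] at hk₃
    rw [hin₃.zero]
    exact ⟨fun e => absurd e h13, fun _ => ⟨by omega, .inr ⟨hin₃.answer, hno⟩⟩⟩
  intro s₃ k₃ c₃ ht₃ hc₃ h13 hinv₃ hforced₃ hk₃
  rw [htime] at hk₃
  rw [ht₃.input.zero]
  refine ⟨fun _ => ?_, fun e => absurd h13 e⟩
  refine runs_topDown ht₃ hadj hroot hc₃ fun s₄ k₄ c₄ ht₄ hc₄ hfill hk₄ => ?_
  rw [htime] at hk₄
  choose d hd using fun v => Option.ne_none_iff_exists'.1 (hfill.done v (ht₄.pos_lt v))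
  have hgood := ht₄.tree.isGoodColoring hG hinv₃ hforced₃ ht₄.pos_lt hfill hd
  refine runs_outputLinks ht₄ hG hadj hroot hgood (fun v => by rw [hc₄ v, hd v])
    fun s₅ k₅ q hq hout hk₅ => ?_
  rw [htime] at hk₅
  exact ⟨by omega, isCorrectOutput_of_isLink ht₄.tree hG hroot hgood hq (by simp)
    (by simpa using hout)⟩

end TopDownAndOutput

end EvenTree

theorem mainTheorem7 :
    -- a linear-time algorithm for all block graphs
    (∃ (P : Program) (K : ℕ), ∀ (n : ℕ) (G : SimpleGraph (Fin n)) (adj : Fin n → List (Fin n)),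
      IsBlockGraph G → IsAdjacencyList G adj →
        ∃ (t : ℕ) (s : RAMState), Exec P (inputState adj) t s ∧
          t ≤ K * (n + G.edgeSet.ncard + 1) ∧ IsCorrectOutput G s) ∧
    -- the coloring procedure is correct, whatever choices are made
    (∀ (V : Type*) [Finite V] (G : SimpleGraph V),
      IsBlockGraph G → G.Connected → 3 ≤ Nat.card V →
        -- both repetitions always terminate
        WellFounded (fun c' c => ForceStep G c c') ∧
        (∀ r : BlockCutNode G, WellFounded (fun c' c => TopDownStep G r c c')) ∧
        ∀ c₁ : V → Option Bool, IsForcedColoring G c₁ →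
          -- every spanning even tree agrees with the forced coloring
          (∀ (T : SimpleGraph V) (c : V → Bool), IsSpanningEvenTree G T → IsAdmissible T c →
            ∀ (v : V) (b : Bool), c₁ v = some b → c v = b) ∧
          -- the answer "no" is correct
          (¬ (bichromatic G c₁).Connected → ¬ ∃ T : SimpleGraph V, IsSpanningEvenTree G T) ∧
          -- otherwise a spanning tree is found, and it is always a spanning even tree of `G`
          ((bichromatic G c₁).Connected →
            ∀ (r : BlockCutNode G) (c₂ : V → Option Bool), Exhaust (TopDownStep G r) c₁ c₂ →
              (bichromatic (bichromatic G c₁) c₂).Connected ∧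
              ∀ T : SimpleGraph V, T ≤ bichromatic (bichromatic G c₁) c₂ → T.IsTree →
                IsSpanningEvenTree G T)) := by
  refine ⟨⟨spanningEvenTreeProgram, 200, fun n G adj hG hadj => ?_⟩,
    fun V _ G hG hc hcard => coloring_procedure_correct G hG hc hcard⟩
  obtain ⟨t, s, hexec, ht, hs⟩ := runs_spanningEvenTreeProgram hG hadj
  exact ⟨t, s, hexec, by simpa using ht, hs⟩
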